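/- **Setting.** Let $\mathcal M=(\mathcal S,P,R,\mu)$ be a Markov reward process on a countable state space $\mathcal S$ that contains an absorbing terminal state $\emptyset$: $P$ is a transition matrix with $P(\emptyset,\emptyset)=1$, $R(\cdot\mid s)$ is the law of the reward collected in state $s$ (supported in $[-1,1]$, with no reward in $\emptyset$), and $\mu$ is the initial distribution. A trajectory is generated by $S_0\sim\mu$, $R_t\sim R(\cdot\mid S_t)$, $S_{t+1}\sim P(\cdot\mid S_t)$ (with $R_t$ and $S_{t+1}$ conditionally independent given $S_t$ and the past), until $T=\min\{t\ge 0:S_t=\emptyset\}$; put $S_t=\emptyset$, $R_t=0$ for $t\ge T$. Assume that for some $h$ we have $\mathbb E[T_\emptyset^p\mid S_0=s]\le (ph)^p$ for all $s\ne\emptyset$ and all integers $p\ge1$, where $T_\emptyset=\inf\{t>0:S_t=\emptyset\}$. Write $$V^\star(s)=\mathbb E\Big[\sum_{t=0}^{T-1}R_t\,\Big|\,S_0=s\Big],\qquad \sigma^2(s)=\operatorname{Var}\big[R_0+V^\star(S_1)\mid S_0=s\big],\qquad \nu(s)=\sum_{t\ge0}\mathbb P_\mu(S_t=s).$$ Let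 $\mathcal G\subset\mathcal S\setminus\{\emptyset\}$ be a finite set containing a target state $s_0$, let $P_{\mathcal G}=(P(s,s'))_{s,s'\in\mathcal G}$ and $V^\star_{\mathcal G}=V^\star|_{\mathcal G}$. **Estimator.** Given i.i.d. trajectories $\tau_1,\tau_2,\dots$, let $B(s)=\{(i,t): i\le n,\ S^{(i)}_t=s\}$ for $s\in\mathcal G$ and, with $0/0=0$, $$\widehat r_{\mathcal G}(s)=\frac1{|B(s)|}\sum_{(i,t)\in B(s)}R^{(i)}_t,\qquad \widehat P_{\mathcal G}(s,s')=\frac1{|B(s)|}\sum_{(i,t)\in B(s)}\mathbf 1\{S^{(i)}_{t+1}=s'\},$$ $$\widehat V_{\mathrm{out}}(s)=\frac1{|B(s)|}\sum_{(i,t)\in B(s)}\mathbf 1\{S^{(i)}_{t+1}\notin\mathcal G\}\sum_{\ell>t}R^{(i)}_{\ell}.$$ The subgraph Bellman estimator $\widehat V_{\mathcal G}\in\mathbb R^{\mathcal G}$ (based on the first $n$ trajectories) is the solution of $\widehat V_{\mathcal G}=\widehat r_{\mathcal G}+\widehat P_{\mathcal G}\widehat V_{\mathcal G}+\widehat V_{\mathrm{out}}$.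 **Covariances.** For $s,s'\in\mathcal G$, with all probabilities under $S_0\sim\mu$, let $$E(s,s')=\sum_{t,t'\ge0}\ \sum_{j\ge (t\vee t')+1}\ \sum_{s''\in\mathcal S}\mathbb P(S_t=s,\,S_{t'}=s',\,S_{t+1}\notin\mathcal G,\,S_{t'+1}\notin\mathcal G,\,S_j=s'')\,\sigma^2(s''),$$ $$C(s,s')=\sum_{t\ge0}\sum_{t'=0}^{t-1}\mathbb P(S_{t'}=s',\,S_{t'+1}\notin\mathcal G,\,S_t=s)\,\sigma^2(s),$$ $$\Lambda^\star_{\mathcal G}(s,s')=\mathbf 1\{s=s'\}\,\nu(s)\,\sigma^2(s)+C(s,s')+C(s',s)+E(s,s'),$$ and $$\Sigma^\star_{\mathcal G}(s,s')=\frac{\Lambda^\star_{\mathcal G}(s,s')}{\nu(s)\nu(s')},\qquad \Sigma^\star_X(s,s')=\mathbf 1\{s=s'\}\frac{\sigma^2(s)}{\nu(s)},\qquad \Sigma^\star_{Y,\mathcal G}(s,s')=\frac{E(s,s')}{\nu(s)\nu(s')}.$$ **Lemma.** Suppose that $\nu(s)>0$ for every $s\in\mathcal G$. Then almost surely the estimator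 $\widehat V_{\mathcal G}$ is well defined (the equation has exactly one solution) for every $n$; $I-P_{\mathcal G}$ is invertible; $\nu(s)$ and all the series above are finite for $s,s'\in\mathcal G$; $\Sigma^\star_{\mathcal G}$ is positive semidefinite; and, as $n\to\infty$, $$\sqrt n\,\big(V^\star_{\mathcal G}-\widehat V_{\mathcal G}\big)\ \xrightarrow{d}\ \mathcal N\Big(0,\ (I-P_{\mathcal G})^{-1}\,\Sigma^\star_{\mathcal G}\,(I-P_{\mathcal G})^{-\top}\Big).$$ Moreover $\Sigma^\star_{\mathcal G}\preccurlyeq 2\Sigma^\star_X+2\Sigma^\star_{Y,\mathcal G}$ in the positive semidefinite order. -/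

import Mathlib

open MeasureTheory ProbabilityTheory Filter Topology
open scoped ENNReal Matrix

noncomputable section

/-- A Markov reward process: a state space `S` (containing the absorbing terminal state `term`),
a transition kernel `P`, a reward kernel `R` and an initial distribution `μ`.
No reward is collected in the terminal state. -/
structure MRP (S : Type*) [MeasurableSpace S] where
  /-- terminal state -/
  term : S
  /-- transition kernel -/
  P : Kernel S S
  /-- reward kernel: `R s` is the law of the reward collected in state `s` -/
  R : Kernel S ℝ
  /-- initial distribution -/
  μ : Measure S
  markov_P : IsMarkovKernel P
  markov_R : IsMarkovKernel R
  prob_μ : IsProbabilityMeasure μ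
  P_term : P term = Measure.dirac term
  R_term : R term = Measure.dirac 0

attribute [instance] MRP.markov_P MRP.markov_R MRP.prob_μ

/-- A sequence of (state, reward) pairs `(S_t, R_t)`, `t = 0, 1, 2, …`. A trajectory that terminates
at time `T` is represented by the sequence that stays in the terminal state from time `T` on. -/
abbrev StatePath (S : Type*) : Type _ := ℕ → S × ℝ

namespace MRP

variable {S : Type*} [MeasurableSpace S] (M : MRP S)

/-- One step of the chain of pairs: given `(S_t, R_t)`, draw `S_{t+1} ∼ P(· | S_t)` and then
`R_{t+1} ∼ R(· | S_{t+1})`. -/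
def step (n : ℕ) : Kernel ((i : Finset.Iic n) → (fun _ : ℕ => S × ℝ) i) (S × ℝ) :=
  (M.P ⊗ₖ Kernel.prodMkLeft S M.R).comap (fun x => (x ⟨n, Finset.mem_Iic.2 le_rfl⟩).1)
    (measurable_fst.comp (measurable_pi_apply _))

instance (n : ℕ) : IsMarkovKernel (M.step n) := by
  unfold step; infer_instance

/-- Law of the sequence `(S_t, R_t)_{t ≥ 0}` when `S_0 ∼ ρ`. -/
def pathLaw (ρ : Measure S) : Measure (StatePath S) :=
  Kernel.trajMeasure (X := fun _ : ℕ => S × ℝ) (ρ ⊗ₘ M.R) M.step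

/-- Law of the sequence `(S_t, R_t)_{t ≥ 0}` started from `S_0 = s`. -/
def lawFrom (s : S) : Measure (StatePath S) := M.pathLaw (Measure.dirac s)

/-- Law of the sequence `(S_t, R_t)_{t ≥ 0}` when `S_0 ∼ μ`. -/
def law : Measure (StatePath S) := M.pathLaw M.μ

/-- `T_∅ = inf {t > 0 : S_t = ∅}`, with value `∞` if the terminal state is never hit. -/
def hitTime (w : StatePath S) : ℝ≥0∞ :=
  ⨅ (t : ℕ) (_ : 0 < t ∧ (w t).1 = M.term), (t : ℝ≥0∞)

/-- Effective horizon: `E_s[T_∅ ^ p] ≤ (p h) ^ p` for every non-terminal `s` and every `p ≥ 1`. -/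
def EffectiveHorizon (h : ℝ) : Prop :=
  ∀ s, s ≠ M.term → ∀ p : ℕ, 1 ≤ p →
    ∫⁻ w, M.hitTime w ^ p ∂M.lawFrom s ≤ ENNReal.ofReal ((p * h) ^ p)

/-- All rewards lie in `[-1, 1]` almost surely. -/
def BoundedRewards : Prop := ∀ s, ∀ᵐ r ∂M.R s, |r| ≤ 1

/-- Length `T` of a trajectory: the first `t ≥ 0` with `S_t = ∅` (and `0` if there is none). -/
def len (w : StatePath S) : ℕ := sInf {t | (w t).1 = M.term}

/-- Value function `V⋆(s) = E[∑_{t=0}^{T-1} R_t | S_0 = s]`. -/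
def V (s : S) : ℝ := ∫ w, ∑ t ∈ Finset.range (M.len w), (w t).2 ∂M.lawFrom s

/-- One-step variance `σ²(s) = Var[R_0 + V⋆(S_1) | S_0 = s]`. -/
def oneStepVar (s : S) : ℝ := Var[fun w => (w 0).2 + M.V (w 1).1; M.lawFrom s]

/-- Occupancy measure `ν(s) = ∑_t P_μ(S_t = s)`. -/
def occ (s : S) : ℝ≥0∞ := ∑' t : ℕ, M.law {w | (w t).1 = s}

/-! ### Population matrices of a subgraph `G` -/

/-- The transition matrix restricted to `G`. -/
def transG (G : Finset S) : Matrix G G ℝ := Matrix.of fun s s' => (M.P s).real {s'.1}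

/-- `∑_t ∑_{t' < t} P(S_{t'} = s', S_{t'+1} ∉ G, S_t = s) σ²(s)`. -/
def crossSum (G : Finset S) (s s' : S) : ℝ≥0∞ :=
  ∑' t : ℕ, ∑ t' ∈ Finset.range t,
    M.law {w | (w t').1 = s' ∧ (w (t' + 1)).1 ∉ G ∧ (w t).1 = s} * ENNReal.ofReal (M.oneStepVar s)

/-- `∑_{t, t'} ∑_{j > max t t'} ∑_{s''} P(S_t = s, S_{t'} = s', S_{t+1}, S_{t'+1} ∉ G, S_j = s'')
σ²(s'')`. -/
def exitSum (G : Finset S) (s s' : S) : ℝ≥0∞ :=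
  ∑' (t : ℕ) (t' : ℕ) (j : {j : ℕ // max t t' + 1 ≤ j}) (s'' : S),
    M.law {w | (w t).1 = s ∧ (w t').1 = s' ∧ (w (t' + 1)).1 ∉ G ∧ (w (t + 1)).1 ∉ G ∧
      (w j).1 = s''} * ENNReal.ofReal (M.oneStepVar s'')

open Classical in
/-- The unnormalized covariance `Λ⋆_G(s, s')`. -/
def lambdaG (G : Finset S) (s s' : S) : ℝ≥0∞ :=
  (if s = s' then ∑' t : ℕ, M.law {w | (w t).1 = s} * ENNReal.ofReal (M.oneStepVar s) else 0)
    + (M.crossSum G s s' + M.crossSum G s' s) + M.exitSum G s s'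

/-- `Σ⋆_G(s, s') = Λ⋆_G(s, s') / (ν(s) ν(s'))`. -/
def sigmaG (G : Finset S) : Matrix G G ℝ :=
  Matrix.of fun s s' => (M.lambdaG G s s').toReal / ((M.occ s).toReal * (M.occ s').toReal)

open Classical in
/-- `Σ⋆_X = diag (σ²(s) / ν(s))`. -/
def sigmaX (G : Finset S) : Matrix G G ℝ :=
  Matrix.diagonal fun s => M.oneStepVar s / (M.occ s).toReal

/-- `Σ⋆_{Y,G}(s, s')`: exit-path covariance divided by `ν(s) ν(s')`. -/
def sigmaY (G : Finset S) : Matrix G G ℝ :=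
  Matrix.of fun s s' => (M.exitSum G s s').toReal / ((M.occ s).toReal * (M.occ s').toReal)

/-! ### The estimator computed from the first `n` trajectories of a data set `D` -/

open Classical in
/-- Indices `(i, t)`, `i < n`, `0 ≤ t ≤ T_i`, with `S_t⁽ⁱ⁾ = s`, that is, the sub-trajectories of the
pooled data set which start in `s`. -/
def visits (n : ℕ) (D : ℕ → StatePath S) (s : S) : Finset (Σ _ : ℕ, ℕ) :=
  ((Finset.range n).sigma fun i => Finset.range (M.len (D i) + 1)).filter
    fun q => (D q.1 q.2).1 = s

/-- Empirical conditional expectation `Ê[f(τ) | S_0(τ) = s]` over the pooled sub-trajectories, with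
`0 / 0 = 0`. -/
def empCond (n : ℕ) (D : ℕ → StatePath S) (s : S) (f : StatePath S → ℝ) : ℝ :=
  (∑ q ∈ M.visits n D s, f fun k => D q.1 (q.2 + k)) / (M.visits n D s).card

/-- Empirical mean reward on `G`. -/
def rHat (G : Finset S) (n : ℕ) (D : ℕ → StatePath S) : G → ℝ :=
  fun s => M.empCond n D s fun w => (w 0).2

open Classical in
/-- Empirical transition matrix restricted to `G`. -/
def transHat (G : Finset S) (n : ℕ) (D : ℕ → StatePath S) : Matrix G G ℝ :=
  Matrix.of fun s s' => M.empCond n D s fun w => if (w 1).1 = s' then 1 else 0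

open Classical in
/-- Monte Carlo estimate of the reward collected after a direct exit from `G`:
`Ê[1_{S_1 ∉ G} ∑_{ℓ = 1}^{T - 1} R_ℓ | S_0 = s]`. -/
def outHat (G : Finset S) (n : ℕ) (D : ℕ → StatePath S) : G → ℝ :=
  fun s => M.empCond n D s fun w =>
    if (w 1).1 ∉ G then ∑ l ∈ Finset.Ico 1 (M.len w), (w l).2 else 0

/-- `v` solves the empirical subgraph Bellman equation `v = r̂_G + P̂_G v + V̂_out`. -/
def IsSubgraphBellman (G : Finset S) (n : ℕ) (D : ℕ → StatePath S) (v : G → ℝ) : Prop :=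
  v = M.rHat G n D + M.transHat G n D *ᵥ v + M.outHat G n D

end MRP

end

set_option linter.unusedSectionVars false

noncomputable section

/-! ### Markov property of the trajectory law. -/

namespace MRP

variable {S : Type*} [MeasurableSpace S] (M : MRP S)

/-! Put `V⋆` into the empirical Bellman equation and look at one trajectory. Let `δ_j = R_j +
V⋆(S_{j+1}) - V⋆(S_j)` be the temporal difference. A visit to `s` at time `t` followed by a state of
`G` contributes `δ_t` to the residual. If `S_{t+1} ∉ G`, the Monte Carlo return takes the place of
`V⋆(S_{t+1})`, and by telescoping up to termination the contribution is `δ_t + δ_{t+1} + ⋯`.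
Collecting terms, the total residual at `s` is `∑_j H_j δ_j`, where `H_j` is `1{S_j = s}` plus the
number of direct exits from `G` through `s` before time `j` (`visitSum_residual`).

The weight `H_j` is a function of the trajectory up to `S_j`. By the Bellman equation `δ_j` is
centered given that past, with conditional variance `σ²(S_j)`. The residual is therefore a
martingale transform, with mean zero and second moment `∑_j E[H_j² σ²(S_j)]`
(`martingaleTransform`). This is the squared norm of `H` in `L²(energy)`, and expanding the product
of two weights shows that their inner products are the entries of `Λ⋆` (`lintegral_weight_weight`).
Hence `Σ⋆` is a Gram matrix. With `v` for visits and `e` for exits, the covariance bound is the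
identity `2vv' + 2ee' - (v + e)(v' + e') = (v - e)(v' - e')`, whose right side is again a Gram
kernel.

Once every state of `G` has been visited, `(I - P̂)(V⋆ - V̂)` is minus the summed residual divided
by the number of visits (`V_sub_eq`). The law of large numbers gives `P̂ → P_G` and visits per
trajectory `→ ν`, the central limit theorem applies to the residuals, and Slutsky's theorem combines
them.

Both matrices `I - P̂` and `I - P_G` are invertible by a maximum principle: a nonzero fixed vector
would keep trajectories in `G` forever, whereas they terminate (`isUnit_one_sub_transHat`,
`isUnit_one_sub_transG`). All integrability comes from the finite moments of the length of a
trajectory. -/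

instance isProbabilityMeasure_pathLaw (ρ : Measure S) [IsProbabilityMeasure ρ] :
    IsProbabilityMeasure (M.pathLaw ρ) := by
  unfold pathLaw; infer_instance

instance isProbabilityMeasure_lawFrom (s : S) : IsProbabilityMeasure (M.lawFrom s) := by
  unfold lawFrom; infer_instance

instance isProbabilityMeasure_law : IsProbabilityMeasure M.law := by
  unfold law; infer_instance

theorem lintegral_step (j : ℕ) (x : (i : Finset.Iic j) → (fun _ : ℕ => S × ℝ) i)
    {f : S × ℝ → ℝ≥0∞} (hf : Measurable f) :
    ∫⁻ y, f y ∂M.step j x =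
      ∫⁻ s', ∫⁻ r, f (s', r) ∂M.R s' ∂M.P (x ⟨j, Finset.mem_Iic.2 le_rfl⟩).1 := by
  rw [step, Kernel.comap_apply, Kernel.lintegral_compProd _ _ _ hf]
  rfl

/-- The Markov property as supplied by the Ionescu-Tulcea construction. The history up to time `j`
is encoded as the trajectory frozen at time `j`, so that test functions are defined on whole
trajectories instead of a type depending on `j`. -/
theorem lintegral_next (ρ : Measure S) [IsProbabilityMeasure ρ] (j : ℕ)
    {F : StatePath S × (S × ℝ) → ℝ≥0∞} (hF : Measurable F) :
    ∫⁻ w, F (fun i => w (min i j), w (j + 1)) ∂M.pathLaw ρ =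
      ∫⁻ w, ∫⁻ s', ∫⁻ r, F (fun i => w (min i j), (s', r)) ∂M.R s' ∂M.P (w j).1
        ∂M.pathLaw ρ := by
  let e : ((i : Finset.Iic j) → (fun _ : ℕ => S × ℝ) i) → StatePath S :=
    fun x i => x ⟨min i j, Finset.mem_Iic.2 (min_le_right _ _)⟩
  have he : Measurable e := measurable_pi_lambda _ fun i => measurable_pi_apply _
  have key := Kernel.map_frestrictLe_trajMeasure_compProd_eq_map_trajMeasure
    (X := fun _ : ℕ => S × ℝ) (μ₀ := ρ ⊗ₘ M.R) (κ := M.step) (a := j)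
  have hm : Measurable fun w : (n : ℕ) → (fun _ : ℕ => S × ℝ) n =>
      (Preorder.frestrictLe (π := fun _ : ℕ => S × ℝ) j w, w (j + 1)) := by fun_prop
  have hF' : Measurable fun p : ((i : Finset.Iic j) → (fun _ : ℕ => S × ℝ) i) × (S × ℝ) =>
      F (e p.1, p.2) := by fun_prop
  have h1 : ∫⁻ w, F (fun i => w (min i j), w (j + 1)) ∂M.pathLaw ρ =
      ∫⁻ p, F (e p.1, p.2) ∂((M.pathLaw ρ).map fun w =>
        (Preorder.frestrictLe (π := fun _ : ℕ => S × ℝ) j w, w (j + 1))) := by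
    rw [lintegral_map hF' hm]; rfl
  rw [h1]
  unfold pathLaw
  rw [← key, Measure.lintegral_compProd hF', lintegral_map]
  · refine lintegral_congr fun w => ?_
    rw [lintegral_step _ _ _ (by fun_prop)]
    rfl
  · exact hF'.lintegral_kernel_prod_right'
  · fun_prop

theorem lintegral_zero (ρ : Measure S) [IsProbabilityMeasure ρ] {f : S × ℝ → ℝ≥0∞}
    (hf : Measurable f) :
    ∫⁻ w, f (w 0) ∂M.pathLaw ρ = ∫⁻ s, ∫⁻ r, f (s, r) ∂M.R s ∂ρ := by
  have h : (M.pathLaw ρ).map (Preorder.frestrictLe (π := fun _ : ℕ => S × ℝ) 0) =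
      (ρ ⊗ₘ M.R).map (MeasurableEquiv.piUnique fun _ : Finset.Iic 0 => S × ℝ).symm := by
    unfold pathLaw Kernel.trajMeasure
    rw [Measure.map_comp _ _ (by fun_prop), Kernel.traj_map_frestrictLe, Kernel.partialTraj_self,
      Measure.id_comp]
  let z : Finset.Iic 0 := ⟨0, Finset.mem_Iic.2 le_rfl⟩
  have hz : Measurable fun x : (i : Finset.Iic 0) → (fun _ : ℕ => S × ℝ) i => f (x z) := by
    fun_prop
  have h1 : ∫⁻ w, f (w 0) ∂M.pathLaw ρ =
      ∫⁻ x, f (x z) ∂(M.pathLaw ρ).map (Preorder.frestrictLe (π := fun _ : ℕ => S × ℝ) 0) := by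
    rw [lintegral_map hz (by fun_prop)]; rfl
  rw [h1, h, lintegral_map hz (by fun_prop), ← Measure.lintegral_compProd hf]
  rfl

/-- Law of the trajectory given the initial pair `(S_0, R_0)`. -/
def pathKernel : Kernel (S × ℝ) (StatePath S) :=
  (Kernel.traj (X := fun _ : ℕ => S × ℝ) M.step 0).comap
    (MeasurableEquiv.piUnique fun _ : Finset.Iic 0 => S × ℝ).symm (MeasurableEquiv.measurable _)

theorem pathLaw_eq_bind (ρ : Measure S) : M.pathLaw ρ = (ρ ⊗ₘ M.R).bind M.pathKernel := by
  unfold pathLaw Kernel.trajMeasure pathKernel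
  rw [Measure.bind, Measure.bind, Measure.map_map (Kernel.measurable _)
    (MeasurableEquiv.measurable _)]
  rfl

/-- Disintegration over the initial state. It carries the horizon hypothesis, which concerns fixed
starting states, over to an arbitrary initial law. -/
theorem lintegral_pathLaw (ρ : Measure S) [IsProbabilityMeasure ρ] {F : StatePath S → ℝ≥0∞}
    (hF : Measurable F) :
    ∫⁻ w, F w ∂M.pathLaw ρ = ∫⁻ s, ∫⁻ w, F w ∂M.lawFrom s ∂ρ := by
  have hk : Measurable fun x => ∫⁻ w, F w ∂M.pathKernel x := hF.lintegral_kernel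
  have h (ρ : Measure S) [IsProbabilityMeasure ρ] : ∫⁻ w, F w ∂M.pathLaw ρ =
      ∫⁻ s, ∫⁻ r, ∫⁻ w, F w ∂M.pathKernel (s, r) ∂M.R s ∂ρ := by
    rw [pathLaw_eq_bind, Measure.lintegral_bind (Kernel.aemeasurable _) hF.aemeasurable,
      Measure.lintegral_compProd hk]
  rw [h]
  refine lintegral_congr fun s => ?_
  rw [lawFrom, h, lintegral_dirac']
  exact hk.lintegral_kernel_prod_right' (κ := M.R)

/-- The trajectory with the reward at time `j` and everything after time `j` erased. -/
def past (j : ℕ) (w : StatePath S) : StatePath S :=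
  fun i => if i < j then w i else ((w j).1, 0)

theorem measurable_past (j : ℕ) : Measurable (past (S := S) j) := by
  refine measurable_pi_lambda _ fun i => ?_
  unfold past
  split_ifs <;> fun_prop

/-- Conditionally on the past, `R_j ∼ R(· | S_j)`. -/
theorem lintegral_past_reward (ρ : Measure S) [IsProbabilityMeasure ρ] (j : ℕ)
    {F : StatePath S × ℝ → ℝ≥0∞} (hF : Measurable F) :
    ∫⁻ w, F (past j w, (w j).2) ∂M.pathLaw ρ =
      ∫⁻ w, ∫⁻ r, F (past j w, r) ∂M.R (w j).1 ∂M.pathLaw ρ := by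
  rcases j with _ | j
  · let c : S → StatePath S := fun s _ => (s, 0)
    have hc : Measurable c := measurable_pi_lambda _ fun _ => by fun_prop
    have hp (w : StatePath S) : past 0 w = c (w 0).1 := by ext i <;> simp [past, c]
    simp_rw [hp]
    have hm : Measurable fun p : S × ℝ => ∫⁻ r, F (c p.1, r) ∂M.R p.1 :=
      (Measurable.lintegral_kernel_prod_right' (κ := M.R) (f := fun p => F (c p.1, p.2))
        (by fun_prop)).comp measurable_fst
    rw [lintegral_zero M ρ (f := fun p => F (c p.1, p.2)) (by fun_prop), lintegral_zero M ρ hm]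
    simp
  · let c : StatePath S × S → StatePath S := fun p i => if i < j + 1 then p.1 i else (p.2, 0)
    have hc : Measurable c := measurable_pi_lambda _ fun i => by
      dsimp only [c]; split_ifs <;> fun_prop
    have hp (w : StatePath S) : past (j + 1) w = c (fun i => w (min i j), (w (j + 1)).1) := by
      ext i <;> simp only [past, c] <;> split_ifs <;> simp [Nat.lt_succ_iff.1, *]
    simp_rw [hp]
    have hm : Measurable fun p : StatePath S × (S × ℝ) =>
        ∫⁻ r, F (c (p.1, p.2.1), r) ∂M.R p.2.1 :=
      Measurable.lintegral_kernel_prod_right' (κ := M.R.comap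
        (fun p : StatePath S × (S × ℝ) => p.2.1) (by fun_prop))
        (f := fun q : (StatePath S × (S × ℝ)) × ℝ => F (c (q.1.1, q.1.2.1), q.2)) (by fun_prop)
    rw [lintegral_next M ρ j (F := fun p => F (c (p.1, p.2.1), p.2.2)) (by fun_prop),
      lintegral_next M ρ j hm]
    simp

/-- Conditionally on the past, `R_j` and `S_{j+1}` are independent with laws `R(· | S_j)` and
`P(· | S_j)`. -/
theorem lintegral_past (ρ : Measure S) [IsProbabilityMeasure ρ] (j : ℕ)
    {F : StatePath S × (ℝ × S) → ℝ≥0∞} (hF : Measurable F) :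
    ∫⁻ w, F (past j w, ((w j).2, (w (j + 1)).1)) ∂M.pathLaw ρ =
      ∫⁻ w, ∫⁻ y, F (past j w, y) ∂(M.R ×ₖ M.P) (w j).1 ∂M.pathLaw ρ := by
  have hp (w : StatePath S) : past j w = past j fun i => w (min i j) := by
    ext i <;> simp only [past] <;> split_ifs with h <;> simp [le_of_lt, *]
  have hs (w : StatePath S) : (w j).1 = (past j w j).1 := by simp [past]
  -- The next state is averaged first, with `R_j` still part of the history; then `R_j` is averaged
  -- given `past j`.
  have h1 := lintegral_next M ρ j (F := fun p => F (past j p.1, ((p.1 j).2, p.2.1)))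
    (by have := measurable_past (S := S) j; fun_prop)
  simp only [min_self, ← hp, lintegral_const, measure_univ, mul_one] at h1
  have hm : Measurable fun p : StatePath S × ℝ => ∫⁻ s', F (p.1, (p.2, s')) ∂M.P (p.1 j).1 :=
    Measurable.lintegral_kernel_prod_right' (κ := M.P.comap
      (fun p : StatePath S × ℝ => (p.1 j).1) (by fun_prop))
      (f := fun q : (StatePath S × ℝ) × S => F (q.1.1, (q.1.2, q.2))) (by fun_prop)
  have h2 := lintegral_past_reward M ρ j hm
  simp only [← hs] at h2
  rw [h1, h2]
  refine lintegral_congr fun w => ?_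
  rw [Kernel.prod_apply, lintegral_prod _ (by fun_prop)]

/-- The same Markov property as an identity of measures, which gives access to Fubini for signed
integrands. -/
theorem map_past (ρ : Measure S) [IsProbabilityMeasure ρ] (j : ℕ) :
    (M.pathLaw ρ).map (fun w => (past j w, ((w j).2, (w (j + 1)).1))) =
      ((M.pathLaw ρ).map (past j)) ⊗ₘ
        ((M.R ×ₖ M.P).comap (fun v : StatePath S => (v j).1) (by fun_prop)) := by
  have hp := measurable_past (S := S) j
  have hs (w : StatePath S) : (past j w j).1 = (w j).1 := by simp [past]
  refine Measure.ext_of_lintegral _ fun F hF => ?_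
  rw [lintegral_map hF (by fun_prop), lintegral_past M ρ j hF, Measure.lintegral_compProd hF,
    lintegral_map hF.lintegral_kernel_prod_right' hp]
  simp [Kernel.comap_apply, hs]

/-- Markov property, for real functions. -/
theorem integral_past (ρ : Measure S) [IsProbabilityMeasure ρ] (j : ℕ)
    {F : StatePath S × (ℝ × S) → ℝ} (hF : Measurable F)
    (hi : Integrable (fun w => F (past j w, ((w j).2, (w (j + 1)).1))) (M.pathLaw ρ)) :
    ∫ w, F (past j w, ((w j).2, (w (j + 1)).1)) ∂M.pathLaw ρ =
      ∫ w, ∫ y, F (past j w, y) ∂(M.R ×ₖ M.P) (w j).1 ∂M.pathLaw ρ := by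
  have hp := measurable_past (S := S) j
  have hs (w : StatePath S) : (past j w j).1 = (w j).1 := by simp [past]
  have hm : Measurable fun w : StatePath S => (past j w, ((w j).2, (w (j + 1)).1)) := by fun_prop
  have hi' := (integrable_map_measure (hF.aestronglyMeasurable) hm.aemeasurable).2 hi
  rw [← integral_map (φ := fun w : StatePath S => (past j w, ((w j).2, (w (j + 1)).1)))
    hm.aemeasurable hF.aestronglyMeasurable]
  rw [map_past] at hi' ⊢
  rw [Measure.integral_compProd hi', integral_map hp.aemeasurable
    hF.stronglyMeasurable.integral_kernel_prod_right'.aestronglyMeasurable]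
  simp [Kernel.comap_apply, hs]

end MRP

namespace MRP

/-! ### Terminating trajectories and moments of their length. -/

section Regular

variable {S : Type*} [MeasurableSpace S] (M : MRP S)

/-- Trajectories that terminate, stay in the terminal state without collecting rewards, and whose
rewards are bounded by one. -/
def IsRegular (w : StatePath S) : Prop :=
  (∃ t, (w t).1 = M.term) ∧
    ∀ t, |(w t).2| ≤ 1 ∧ ((w t).1 = M.term → (w t).2 = 0 ∧ (w (t + 1)).1 = M.term)

theorem ae_reward_prod (s : S) {p : ℝ → Prop} (h : ∀ᵐ r ∂M.R s, p r) :
    ∀ᵐ y ∂(M.R ×ₖ M.P) s, p y.1 := by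
  rw [Kernel.prod_apply]
  exact Measure.quasiMeasurePreserving_fst.ae h

theorem ae_state_prod (s : S) {p : S → Prop} (h : ∀ᵐ r ∂M.P s, p r) :
    ∀ᵐ y ∂(M.R ×ₖ M.P) s, p y.2 := by
  rw [Kernel.prod_apply]
  exact Measure.quasiMeasurePreserving_snd.ae h

theorem len_le_hitTime (w : StatePath S) : (M.len w : ℝ≥0∞) ≤ M.hitTime w := by
  refine le_iInf₂ fun t ht => ?_
  exact_mod_cast Nat.sInf_le ht.2

theorem len_eq_zero {w : StatePath S} (h : (w 0).1 = M.term) : M.len w = 0 :=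
  Nat.eq_zero_of_le_zero (Nat.sInf_le h)

theorem IsRegular.term_iff {M : MRP S} {w : StatePath S} (hw : M.IsRegular w) (t : ℕ) :
    (w t).1 = M.term ↔ M.len w ≤ t := by
  refine ⟨fun h => Nat.sInf_le h, fun h => ?_⟩
  induction t, h using Nat.le_induction with
  | base => exact Nat.sInf_mem hw.1
  | succ k _ ih => exact ((hw.2 k).2 ih).2

variable [Countable S] [MeasurableSingletonClass S]

theorem measurable_comp_state {β : Type*} [MeasurableSpace β] (f : S → β) (t : ℕ) :
    Measurable fun w : StatePath S => f (w t).1 :=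
  (Measurable.of_discrete (f := f)).comp (by fun_prop)

theorem measurableSet_state (A : Set S) (t : ℕ) :
    MeasurableSet {w : StatePath S | (w t).1 ∈ A} :=
  (measurable_fst.comp (measurable_pi_apply t)) (MeasurableSet.of_discrete (s := A))

/-- Transfers an almost sure property of one transition to the trajectory. Countability of `S` makes
the exceptional set measurable: it is a countable union of slices over the states. -/
theorem ae_transition (ρ : Measure S) [IsProbabilityMeasure ρ] (j : ℕ) {p : S → ℝ × S → Prop}
    (hm : ∀ s, MeasurableSet {y | p s y}) (hp : ∀ s, ∀ᵐ y ∂(M.R ×ₖ M.P) s, p s y) :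
    ∀ᵐ w ∂M.pathLaw ρ, p (w j).1 ((w j).2, (w (j + 1)).1) := by
  have hB : MeasurableSet {q : S × (ℝ × S) | ¬ p q.1 q.2} := by
    have : {q : S × (ℝ × S) | ¬ p q.1 q.2} = ⋃ s, {s} ×ˢ {y | p s y}ᶜ := by
      ext ⟨s, y⟩; simp
    rw [this]
    exact MeasurableSet.iUnion fun s => (measurableSet_singleton s).prod (hm s).compl
  have hB' : MeasurableSet {w : StatePath S | ¬ p (w j).1 ((w j).2, (w (j + 1)).1)} :=
    (show Measurable fun w : StatePath S => ((w j).1, ((w j).2, (w (j + 1)).1)) by fun_prop) hB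
  rw [ae_iff, ← lintegral_indicator_one hB']
  have key := M.lintegral_past ρ j
    (F := fun q => {q : S × (ℝ × S) | ¬ p q.1 q.2}.indicator 1 ((q.1 j).1, q.2))
    ((measurable_one.indicator hB).comp (by fun_prop))
  have hs (w : StatePath S) : (past j w j).1 = (w j).1 := by simp [past]
  simp only [hs] at key
  refine key.trans ?_
  rw [lintegral_eq_zero_iff']
  · refine ae_of_all _ fun w => ?_
    simp only [Pi.zero_apply]
    refine lintegral_eq_zero_of_ae_eq_zero ?_
    filter_upwards [hp (w j).1] with y hy
    simp [hy]
  · refine Measurable.aemeasurable ?_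
    exact measurable_comp_state (fun s => ∫⁻ y, {q : S × (ℝ × S) | ¬ p q.1 q.2}.indicator 1
      (s, y) ∂(M.R ×ₖ M.P) s) j

theorem ae_initial (s : S) : ∀ᵐ w ∂M.lawFrom s, (w 0).1 = s := by
  have hB : MeasurableSet {y : S × ℝ | y.1 ≠ s} :=
    measurable_fst (measurableSet_singleton s).compl
  rw [ae_iff, ← lintegral_indicator_one
    (show MeasurableSet {w : StatePath S | ¬ (w 0).1 = s} from measurableSet_state {s}ᶜ 0)]
  refine (M.lintegral_zero (Measure.dirac s) (measurable_one.indicator hB)).trans ?_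
  rw [lintegral_dirac]
  simp

theorem ae_absorbing (hR : M.BoundedRewards) (ρ : Measure S) [IsProbabilityMeasure ρ] :
    ∀ᵐ w ∂M.pathLaw ρ, ∀ t,
      |(w t).2| ≤ 1 ∧ ((w t).1 = M.term → (w t).2 = 0 ∧ (w (t + 1)).1 = M.term) := by
  refine ae_all_iff.2 fun t => ?_
  have h1 := M.ae_transition ρ t (p := fun _ y => |y.1| ≤ 1)
    (fun s => measurableSet_le (by fun_prop) measurable_const)
    fun s => M.ae_reward_prod s (hR s)
  have h2 := M.ae_transition ρ t (p := fun s y => s = M.term → y.1 = 0)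
    (fun s => MeasurableSet.imp (by simp) (measurable_fst (measurableSet_singleton 0)))
    fun s => M.ae_reward_prod s (p := fun r => s = M.term → r = 0) (by
      by_cases hs : s = M.term
      · subst hs; rw [M.R_term, ae_dirac_eq]; simp
      · simp [hs])
  have h3 := M.ae_transition ρ t (p := fun s y => s = M.term → y.2 = M.term)
    (fun s => MeasurableSet.imp (by simp) (measurable_snd (measurableSet_singleton _)))
    fun s => M.ae_state_prod s (p := fun s' => s = M.term → s' = M.term) (by
      by_cases hs : s = M.term
      · subst hs; rw [M.P_term, ae_dirac_eq]; simp
      · simp [hs])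
  filter_upwards [h1, h2, h3] with w a b c
  exact ⟨a, fun h => ⟨b h, c h⟩⟩

theorem measurable_len : Measurable M.len := by
  refine measurable_to_countable' fun n => ?_
  -- The second alternative accounts for the default value `sInf ∅ = 0` on trajectories that never
  -- terminate.
  have : M.len ⁻¹' {n} = {w : StatePath S | ((w n).1 = M.term ∧ ∀ k < n, (w k).1 ≠ M.term) ∨
      (n = 0 ∧ ∀ k, (w k).1 ≠ M.term)} := by
    ext w
    simp only [Set.mem_preimage, Set.mem_singleton_iff, Set.mem_ofPred_eq]
    constructor
    · intro h
      by_cases he : ∃ t, (w t).1 = M.term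
      · left
        have hm : M.len w ∈ {t | (w t).1 = M.term} := Nat.sInf_mem he
        rw [h] at hm
        refine ⟨hm, fun k hk hk' => ?_⟩
        have : M.len w ≤ k := Nat.sInf_le hk'
        omega
      · right
        push Not at he
        refine ⟨?_, he⟩
        rw [← h, len, Nat.sInf_eq_zero]
        right; ext; simp [he]
    · rintro (⟨h1, h2⟩ | ⟨rfl, h⟩)
      · refine le_antisymm (Nat.sInf_le h1) ?_
        by_contra hlt
        exact h2 _ (not_le.1 hlt) (Nat.sInf_mem (s := {t | (w t).1 = M.term}) ⟨n, h1⟩)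
      · rw [len, Nat.sInf_eq_zero]
        right; ext; simp [h]
  rw [this]
  have hs (A : Set S) (t : ℕ) := measurableSet_state A t
  simp only [Set.ofPred_or, Set.ofPred_and, Set.ofPred_forall]
  refine MeasurableSet.union (MeasurableSet.inter (hs {M.term} n) ?_)
    (MeasurableSet.inter (MeasurableSet.const _) ?_)
  · exact MeasurableSet.iInter fun k => MeasurableSet.iInter fun _ => hs {M.term}ᶜ k
  · exact MeasurableSet.iInter fun k => hs {M.term}ᶜ k

theorem lintegral_len_pow_from {h : ℝ} (hEff : M.EffectiveHorizon h) (s : S) {p : ℕ}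
    (hp : 1 ≤ p) :
    ∫⁻ w, (M.len w : ℝ≥0∞) ^ p ∂M.lawFrom s ≤ ENNReal.ofReal ((p * h) ^ p) := by
  -- The horizon hypothesis excludes the terminal starting state, where the length is zero.
  by_cases hs : s = M.term
  · subst hs
    rw [lintegral_eq_zero_of_ae_eq_zero]
    · exact zero_le
    · filter_upwards [M.ae_initial M.term] with w hw
      simp [M.len_eq_zero hw, Nat.one_le_iff_ne_zero.1 hp]
  · exact (lintegral_mono fun w => pow_le_pow_left' (M.len_le_hitTime w) p).trans (hEff s hs p hp)

theorem lintegral_len_pow {h : ℝ} (hEff : M.EffectiveHorizon h) (ρ : Measure S)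
    [IsProbabilityMeasure ρ] (p : ℕ) :
    ∫⁻ w, (M.len w : ℝ≥0∞) ^ p ∂M.pathLaw ρ < ∞ := by
  rcases Nat.eq_zero_or_pos p with rfl | hp
  · simp
  · have hm : Measurable fun w => (M.len w : ℝ≥0∞) ^ p :=
      (Measurable.of_discrete (f := fun n : ℕ => (n : ℝ≥0∞) ^ p)).comp M.measurable_len
    rw [M.lintegral_pathLaw ρ hm]
    refine (lintegral_mono fun s => M.lintegral_len_pow_from hEff s hp).trans_lt ?_
    simp

theorem ae_isRegular {h : ℝ} (hEff : M.EffectiveHorizon h) (hR : M.BoundedRewards)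
    (ρ : Measure S) [IsProbabilityMeasure ρ] : ∀ᵐ w ∂M.pathLaw ρ, M.IsRegular w := by
  have hA : MeasurableSet {w : StatePath S | ¬ ∃ t, (w t).1 = M.term} := by
    push Not
    simp only [Set.ofPred_forall]
    exact MeasurableSet.iInter fun k => measurableSet_state {M.term}ᶜ k
  have h0 (s : S) : M.lawFrom s {w | ¬ ∃ t, (w t).1 = M.term} = 0 := by
    by_cases hs : s = M.term
    · subst hs
      rw [← ae_iff]
      filter_upwards [M.ae_initial M.term] with w hw using ⟨0, hw⟩
    · by_contra hne
      have h1 := hEff s hs 1 le_rfl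
      -- The hitting time is infinite on the set of trajectories that never terminate, so positive
      -- mass there would contradict the finite first moment.
      have h2 : ∫⁻ w, {w : StatePath S | ¬ ∃ t, (w t).1 = M.term}.indicator (fun _ => ∞) w
          ∂M.lawFrom s ≤ ∫⁻ w, M.hitTime w ^ 1 ∂M.lawFrom s := by
        refine lintegral_mono fun w => ?_
        by_cases hw : ∃ t, (w t).1 = M.term
        · simp [hw]
        · have : M.hitTime w = ∞ := by
            simp only [hitTime, iInf_eq_top]
            exact fun t ht => absurd ⟨t, ht.2⟩ hw
          simp [this]
      rw [lintegral_indicator_const hA, ENNReal.top_mul hne] at h2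
      exact absurd (h2.trans h1) (by simp)
  have h1 : ∀ᵐ w ∂M.pathLaw ρ, ∃ t, (w t).1 = M.term := by
    rw [ae_iff, ← lintegral_indicator_one hA, M.lintegral_pathLaw ρ (measurable_one.indicator hA)]
    simp_rw [lintegral_indicator_one hA, h0]
    simp
  filter_upwards [h1, M.ae_absorbing hR ρ] with w a b using ⟨a, b⟩

end Regular

end MRP

namespace MRP

/-! ### The value function, the Bellman equation and the one-step variance. -/

section Value

variable {S : Type*} [MeasurableSpace S] [Countable S] [MeasurableSingletonClass S] (M : MRP S)

theorem measurable_sum_len {β : Type*} [MeasurableSpace β] [AddCommMonoid β] [MeasurableAdd₂ β]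
    {g : ℕ → StatePath S → β} (hg : ∀ t, Measurable (g t)) :
    Measurable fun w => ∑ t ∈ Finset.range (M.len w), g t w := by
  have h : Measurable fun p : ℕ × StatePath S => ∑ t ∈ Finset.range p.1, g t p.2 :=
    measurable_from_prod_countable_right fun n =>
      Finset.measurable_fun_sum (Finset.range n) fun t _ => hg t
  exact h.comp (M.measurable_len.prodMk measurable_id)

theorem abs_sum_reward_le {w : StatePath S} (hw : M.IsRegular w) :
    |∑ t ∈ Finset.range (M.len w), (w t).2| ≤ M.len w := by
  refine (Finset.abs_sum_le_sum_abs _ _).trans ?_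
  refine (Finset.sum_le_sum fun t _ => (hw.2 t).1).trans ?_
  simp

theorem integrable_len_pow {h : ℝ} (hEff : M.EffectiveHorizon h) (ρ : Measure S)
    [IsProbabilityMeasure ρ] (p : ℕ) :
    Integrable (fun w => (M.len w : ℝ) ^ p) (M.pathLaw ρ) := by
  refine ⟨((Measurable.of_discrete (f := fun n : ℕ => (n : ℝ) ^ p)).comp
    M.measurable_len).aestronglyMeasurable, ?_⟩
  refine lt_of_eq_of_lt (lintegral_congr fun w => ?_) (M.lintegral_len_pow hEff ρ p)
  simp [enorm_pow]

theorem abs_V_le {h : ℝ} (hEff : M.EffectiveHorizon h) (hR : M.BoundedRewards) (s : S) :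
    |M.V s| ≤ |h| := by
  have hi : Integrable (fun w => (M.len w : ℝ) ^ 1) (M.lawFrom s) :=
    M.integrable_len_pow hEff (Measure.dirac s) 1
  have h1 : |M.V s| ≤ ∫ w, (M.len w : ℝ) ^ 1 ∂M.lawFrom s := by
    refine norm_integral_le_of_norm_le (G := ℝ) (μ := M.lawFrom s) hi ?_
    filter_upwards [M.ae_isRegular hEff hR (Measure.dirac s)] with w hw
    simpa using M.abs_sum_reward_le hw
  refine h1.trans ?_
  rw [integral_eq_lintegral_of_nonneg_ae (ae_of_all _ fun w => by positivity) hi.1]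
  have h2 := M.lintegral_len_pow_from hEff s le_rfl
  refine ENNReal.toReal_le_of_le_ofReal (abs_nonneg h) ?_
  calc _ = ∫⁻ w, (M.len w : ℝ≥0∞) ^ 1 ∂M.lawFrom s := lintegral_congr fun w => by simp
    _ ≤ ENNReal.ofReal (((1 : ℕ) * h) ^ 1) := h2
    _ ≤ _ := ENNReal.ofReal_le_ofReal (by simpa using le_abs_self h)

theorem V_term : M.V M.term = 0 := by
  refine integral_eq_zero_of_ae ?_
  filter_upwards [M.ae_initial M.term] with w hw
  simp [M.len_eq_zero hw]

/-- Mean reward collected in a state. -/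
def meanReward (s : S) : ℝ := ∫ r, r ∂M.R s

theorem integrable_of_abs_le {α : Type*} [MeasurableSpace α] {μ : Measure α} [IsFiniteMeasure μ]
    {f : α → ℝ} (hf : Measurable f) {c : ℝ} (h : ∀ᵐ x ∂μ, |f x| ≤ c) :
    Integrable f μ :=
  Integrable.of_bound hf.aestronglyMeasurable c h

theorem integrable_state {f : S → ℝ} {c : ℝ} (hf : ∀ s, |f s| ≤ c) (μ : Measure S)
    [IsFiniteMeasure μ] : Integrable f μ :=
  integrable_of_abs_le (Measurable.of_discrete (f := f)) (ae_of_all _ hf)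

theorem integral_state_prod (s : S) (f : S → ℝ) :
    ∫ y, f y.2 ∂(M.R ×ₖ M.P) s = ∫ s', f s' ∂M.P s := by
  rw [Kernel.prod_apply, integral_fun_snd f]
  simp

theorem integral_reward_prod (s : S) (f : ℝ → ℝ) :
    ∫ y, f y.1 ∂(M.R ×ₖ M.P) s = ∫ r, f r ∂M.R s := by
  rw [Kernel.prod_apply, integral_fun_fst f]
  simp

theorem integral_state_succ {f : S → ℝ} {c : ℝ} (hf : ∀ s, |f s| ≤ c) (ρ : Measure S)
    [IsProbabilityMeasure ρ] (t : ℕ) :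
    ∫ w, f (w (t + 1)).1 ∂M.pathLaw ρ = ∫ w, ∫ s', f s' ∂M.P (w t).1 ∂M.pathLaw ρ := by
  have h := M.integral_past ρ t (F := fun q => f q.2.2)
    ((Measurable.of_discrete (f := f)).comp (by fun_prop))
    (integrable_of_abs_le (measurable_comp_state f _)
      (ae_of_all _ fun w => hf _))
  simpa only [integral_state_prod] using h

theorem integral_reward (hR : M.BoundedRewards) (ρ : Measure S)
    [IsProbabilityMeasure ρ] (t : ℕ) :
    ∫ w, (w t).2 ∂M.pathLaw ρ = ∫ w, M.meanReward (w t).1 ∂M.pathLaw ρ := by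
  have h := M.integral_past ρ t (F := fun q => q.2.1) (by fun_prop)
    (integrable_of_abs_le (by fun_prop) (c := 1)
      ((M.ae_absorbing hR ρ).mono fun w hw => (hw t).1))
  simpa only [integral_reward_prod M _ fun r => r, meanReward] using h

theorem abs_integral_le_of_abs_le {α : Type*} [MeasurableSpace α] {μ : Measure α}
    [IsProbabilityMeasure μ] {f : α → ℝ} {c : ℝ} (h : ∀ᵐ x ∂μ, |f x| ≤ c) : |∫ x, f x ∂μ| ≤ c := by
  simpa using norm_integral_le_of_norm_le_const (μ := μ) (f := f) (C := c) h

/-- `E_s f(S_{t+1}) = ∫ E_{s'} f(S_t) P(s, ds')`. -/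
theorem integral_lawFrom_succ (t : ℕ) {f : S → ℝ} {c : ℝ} (hf : ∀ s, |f s| ≤ c) (s : S) :
    ∫ w, f (w (t + 1)).1 ∂M.lawFrom s = ∫ s', ∫ w, f (w t).1 ∂M.lawFrom s' ∂M.P s := by
  have h0 (g : S → ℝ) (s : S) : ∫ w, g (w 0).1 ∂M.lawFrom s = g s := by
    rw [integral_congr_ae (g := fun _ => g s)]
    · simp
    · filter_upwards [M.ae_initial s] with w hw
      rw [hw]
  induction t generalizing f s with
  | zero =>
    rw [lawFrom, integral_state_succ M hf]
    simp_rw [h0 f]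
    exact h0 (fun s => ∫ s', f s' ∂M.P s) s
  | succ t ih =>
    have hPf (s : S) : |∫ s', f s' ∂M.P s| ≤ c := abs_integral_le_of_abs_le (ae_of_all _ hf)
    rw [lawFrom, integral_state_succ M hf]
    -- The last transition is absorbed into the test function, the induction hypothesis is applied
    -- to `P f`, and the last transition is restored under the inner expectation.
    refine (ih hPf s).trans (integral_congr_ae (ae_of_all _ fun s' => ?_))
    exact (integral_state_succ M hf (Measure.dirac s') t).symm

open Classical in
/-- `1_{s ≠ ∅}`. -/
def alive (s : S) : ℝ := if s = M.term then 0 else 1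

theorem abs_alive_le (s : S) : |M.alive s| ≤ 1 := by
  unfold alive; split_ifs <;> simp

theorem alive_nonneg (s : S) : 0 ≤ M.alive s := by
  unfold alive; split_ifs <;> simp

theorem IsRegular.alive_eq {M : MRP S} {w : StatePath S} (hw : M.IsRegular w) (t : ℕ) :
    M.alive (w t).1 = if t < M.len w then 1 else 0 := by
  unfold alive
  simp_rw [hw.term_iff, ← not_lt, ite_not]

/-- The partial sums of `P(S_t ≠ ∅)` are bounded by the mean length. This series dominates every sum
over time that has to be exchanged with an integral below. -/
theorem summable_alive {h : ℝ} (hEff : M.EffectiveHorizon h) (hR : M.BoundedRewards)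
    (ρ : Measure S) [IsProbabilityMeasure ρ] :
    Summable fun t => ∫ w, M.alive (w t).1 ∂M.pathLaw ρ := by
  refine summable_of_sum_range_le (c := ∫ w, (M.len w : ℝ) ^ 1 ∂M.pathLaw ρ)
    (fun t => integral_nonneg fun w => M.alive_nonneg _) fun n => ?_
  rw [← integral_finsetSum _ fun t _ => integrable_of_abs_le
    (measurable_comp_state M.alive t) (ae_of_all _ fun w => M.abs_alive_le _)]
  refine integral_mono_ae ?_ (M.integrable_len_pow hEff ρ 1) ?_
  · exact integrable_finsetSum _ fun t _ => integrable_of_abs_le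
      (measurable_comp_state M.alive t) (ae_of_all _ fun w => M.abs_alive_le _)
  · filter_upwards [M.ae_isRegular hEff hR ρ] with w hw
    simp_rw [hw.alive_eq]
    rw [← Finset.sum_filter, Finset.sum_const]
    simp only [nsmul_eq_mul, mul_one, pow_one, Nat.cast_le]
    calc _ ≤ (Finset.range (M.len w)).card := Finset.card_le_card fun t ht => by
            simp only [Finset.mem_filter] at ht
            exact Finset.mem_range.2 ht.2
      _ = _ := by simp

theorem abs_meanReward_le (hR : M.BoundedRewards) (s : S) : |M.meanReward s| ≤ M.alive s := by
  unfold alive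
  split_ifs with hs
  · subst hs
    simp [meanReward, M.R_term]
  · exact abs_integral_le_of_abs_le (hR s)

/-- Replacing each reward by its conditional mean makes the value a series of expectations of
functions of the state alone. The Bellman equation is then a shift of this series by one step. -/
theorem V_eq_tsum {h : ℝ} (hEff : M.EffectiveHorizon h) (hR : M.BoundedRewards) (s : S) :
    M.V s = ∑' t, ∫ w, M.meanReward (w t).1 ∂M.lawFrom s := by
  have hreg := M.ae_isRegular hEff hR (Measure.dirac s)
  have hle (t : ℕ) : ∀ᵐ w ∂M.lawFrom s, |(w t).2| ≤ M.alive (w t).1 := by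
    filter_upwards [hreg] with w hw
    unfold alive
    split_ifs with ht
    · simp [((hw.2 t).2 ht).1]
    · exact (hw.2 t).1
  have hi (t : ℕ) : Integrable (fun w : StatePath S => (w t).2) (M.lawFrom s) :=
    integrable_of_abs_le (by fun_prop) (hreg.mono fun w hw => (hw.2 t).1)
  have key := integral_tsum_of_summable_integral_norm (μ := M.lawFrom s)
    (F := fun t (w : StatePath S) => (w t).2) hi
    (Summable.of_nonneg_of_le (fun t => integral_nonneg fun w => norm_nonneg _)
      (fun t => integral_mono_ae (hi t).norm (integrable_of_abs_le
        (measurable_comp_state M.alive t)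
        (ae_of_all _ fun w => M.abs_alive_le _)) (hle t))
      (M.summable_alive hEff hR (Measure.dirac s)))
  have h1 : M.V s = ∫ w, ∑' t, (w t).2 ∂M.lawFrom s := by
    refine integral_congr_ae ?_
    filter_upwards [hreg] with w hw
    rw [tsum_eq_sum (s := Finset.range (M.len w))]
    intro t ht
    exact ((hw.2 t).2 ((hw.term_iff t).2 (by simpa using ht))).1
  rw [h1, ← key]
  exact tsum_congr fun t => M.integral_reward hR _ t

/-- The Bellman equation. -/
theorem bellman {h : ℝ} (hEff : M.EffectiveHorizon h) (hR : M.BoundedRewards) (s : S) :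
    M.V s = M.meanReward s + ∫ s', M.V s' ∂M.P s := by
  have hr (s : S) : |M.meanReward s| ≤ 1 :=
    (M.abs_meanReward_le hR s).trans ((le_abs_self _).trans (M.abs_alive_le s))
  have hia (ρ : Measure S) [IsProbabilityMeasure ρ] (t : ℕ) :
      Integrable (fun w : StatePath S => M.alive (w t).1) (M.pathLaw ρ) :=
    integrable_of_abs_le (measurable_comp_state M.alive t)
      (ae_of_all _ fun w => M.abs_alive_le _)
  have hle (s : S) (t : ℕ) : |∫ w, M.meanReward (w t).1 ∂M.lawFrom s| ≤
      ∫ w, M.alive (w t).1 ∂M.lawFrom s :=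
    norm_integral_le_of_norm_le (G := ℝ) (μ := M.lawFrom s) (hia (Measure.dirac s) t)
      (ae_of_all _ fun w => M.abs_meanReward_le hR _)
  have hub (t : ℕ) (s : S) : |∫ w, M.meanReward (w t).1 ∂M.lawFrom s| ≤ 1 :=
    abs_integral_le_of_abs_le (ae_of_all _ fun w => hr _)
  have hua (t : ℕ) (s : S) : |∫ w, M.alive (w t).1 ∂M.lawFrom s| ≤ 1 :=
    abs_integral_le_of_abs_le (ae_of_all _ fun w => M.abs_alive_le _)
  have hsum (s : S) : Summable fun t => ∫ w, M.meanReward (w t).1 ∂M.lawFrom s :=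
    Summable.of_norm_bounded (M.summable_alive hEff hR (Measure.dirac s)) (hle s)
  have h0 : ∫ w, M.meanReward (w 0).1 ∂M.lawFrom s = M.meanReward s := by
    rw [integral_congr_ae (g := fun _ => M.meanReward s)]
    · simp
    · filter_upwards [M.ae_initial s] with w hw
      rw [hw]
  rw [V_eq_tsum M hEff hR, (hsum s).tsum_eq_zero_add, h0]
  congr 1
  simp_rw [V_eq_tsum M hEff hR, integral_lawFrom_succ M _ hr]
  -- The sum over time and the average over the first transition may be exchanged because the terms
  -- are dominated by the shifted series of survival probabilities.
  refine integral_tsum_of_summable_integral_norm (fun t => integrable_state (hub t) _) ?_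
  refine Summable.of_nonneg_of_le (fun t => integral_nonneg fun w => norm_nonneg _) (fun t => ?_)
    ((summable_nat_add_iff 1).2 (M.summable_alive hEff hR (Measure.dirac s)))
  change _ ≤ ∫ w, M.alive (w (t + 1)).1 ∂M.lawFrom s
  rw [integral_lawFrom_succ M t M.abs_alive_le]
  exact integral_mono (integrable_state (hub t) _).norm (integrable_state (hua t) _)
    fun s' => hle s' t

theorem abs_increment_le {h : ℝ} (hEff : M.EffectiveHorizon h) (hR : M.BoundedRewards) (s : S) :
    ∀ᵐ y ∂(M.R ×ₖ M.P) s, |y.1 + M.V y.2 - M.V s| ≤ 1 + 2 * |h| := by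
  filter_upwards [M.ae_reward_prod s (hR s)] with y hy
  have h1 := abs_le.1 (M.abs_V_le hEff hR s)
  have h2 := abs_le.1 (M.abs_V_le hEff hR y.2)
  have h3 := abs_le.1 hy
  rw [abs_le]
  constructor <;> linarith

theorem measurable_increment (s : S) :
    Measurable fun y : ℝ × S => y.1 + M.V y.2 - M.V s := by
  have hV : Measurable M.V := Measurable.of_discrete
  fun_prop

theorem integral_increment {h : ℝ} (hEff : M.EffectiveHorizon h) (hR : M.BoundedRewards) (s : S) :
    ∫ y, (y.1 + M.V y.2 - M.V s) ∂(M.R ×ₖ M.P) s = 0 := by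
  have i1 : Integrable (fun y : ℝ × S => y.1) ((M.R ×ₖ M.P) s) :=
    integrable_of_abs_le measurable_fst (M.ae_reward_prod s (hR s))
  have i2 : Integrable (fun y : ℝ × S => M.V y.2) ((M.R ×ₖ M.P) s) :=
    integrable_of_abs_le ((Measurable.of_discrete (f := M.V)).comp
      measurable_snd) (ae_of_all _ fun y => M.abs_V_le hEff hR _)
  rw [integral_sub (f := fun y : ℝ × S => y.1 + M.V y.2) (i1.add i2) (integrable_const _),
    integral_add i1 i2,
    integral_reward_prod M s fun r => r, integral_state_prod, integral_const]
  have := M.bellman hEff hR s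
  rw [meanReward] at this
  simp [← this]

/-- By the Bellman equation `V⋆(s)` is the mean of `R_0 + V⋆(S_1)`, so the variance is the second
moment of the temporal difference. -/
theorem oneStepVar_eq {h : ℝ} (hEff : M.EffectiveHorizon h) (hR : M.BoundedRewards) (s : S) :
    M.oneStepVar s = ∫ y, (y.1 + M.V y.2 - M.V s) ^ 2 ∂(M.R ×ₖ M.P) s := by
  have hVm := Measurable.of_discrete (f := M.V)
  have h0 (g : ℝ × S → ℝ) (hg : Measurable g) (c : ℝ)
      (hc : ∀ᵐ w ∂M.lawFrom s, |g ((w 0).2, (w 1).1)| ≤ c) :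
      ∫ w, g ((w 0).2, (w 1).1) ∂M.lawFrom s = ∫ y, g y ∂(M.R ×ₖ M.P) s := by
    have := M.integral_past (Measure.dirac s) 0 (F := fun q => g q.2) (by fun_prop)
      (integrable_of_abs_le (by fun_prop) hc)
    refine this.trans ?_
    rw [integral_congr_ae (g := fun _ => ∫ y, g y ∂(M.R ×ₖ M.P) s)]
    · simp
    · filter_upwards [M.ae_initial s] with w hw
      simp [hw]
  have hb : ∀ᵐ w ∂M.lawFrom s, |(w 0).2 + M.V (w 1).1 - M.V s| ≤ 1 + 2 * |h| := by
    filter_upwards [M.ae_absorbing hR (Measure.dirac s)] with w hw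
    have h1 := abs_le.1 (M.abs_V_le hEff hR s)
    have h2 := abs_le.1 (M.abs_V_le hEff hR (w 1).1)
    have h3 := abs_le.1 (hw 0).1
    rw [abs_le]
    constructor <;> linarith
  have hm := M.measurable_increment s
  have hX : Measurable fun w : StatePath S => (w 0).2 + M.V (w 1).1 :=
    Measurable.add (by fun_prop) (measurable_comp_state M.V 1)
  have hmean : ∫ w, (w 0).2 + M.V (w 1).1 ∂M.lawFrom s = M.V s := by
    have h1 := (h0 _ hm _ hb).trans (M.integral_increment hEff hR s)
    have hi : Integrable (fun w : StatePath S => (w 0).2 + M.V (w 1).1 - M.V s) (M.lawFrom s) :=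
      integrable_of_abs_le (hX.sub_const _) hb
    have h2 := integral_add hi (integrable_const (M.V s))
    rw [h1] at h2
    simpa using h2
  rw [oneStepVar, variance_eq_integral hX.aemeasurable, hmean]
  refine h0 _ (hm.pow_const 2) ((1 + 2 * |h|) ^ 2) ?_
  filter_upwards [hb] with w hw
  rw [abs_pow]
  gcongr

theorem oneStepVar_nonneg (s : S) : 0 ≤ M.oneStepVar s := variance_nonneg _ _

/-- Both the reward and the next state are deterministic in the terminal state, whence the factor
`alive`. It is this factor that makes sums of `σ²(S_j)` over all times finite. -/
theorem oneStepVar_le {h : ℝ} (hEff : M.EffectiveHorizon h) (hR : M.BoundedRewards) (s : S) :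
    M.oneStepVar s ≤ (1 + 2 * |h|) ^ 2 * M.alive s := by
  rw [M.oneStepVar_eq hEff hR]
  unfold alive
  split_ifs with hs
  · subst hs
    refine le_of_eq ?_
    rw [mul_zero]
    refine integral_eq_zero_of_ae ?_
    have h1 := M.ae_reward_prod M.term (p := fun r => r = 0) (by rw [M.R_term, ae_dirac_eq]; simp)
    have h2 := M.ae_state_prod M.term (p := fun s => s = M.term)
      (by rw [M.P_term, ae_dirac_eq]; simp)
    filter_upwards [h1, h2] with y h1 h2
    simp [h1, h2]
  · rw [mul_one]
    refine (le_abs_self _).trans (abs_integral_le_of_abs_le ?_)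
    filter_upwards [M.abs_increment_le hEff hR s] with y hy
    rw [abs_pow]
    gcongr

end Value

end MRP

namespace MRP

/-! ### Martingale transforms of the temporal differences. -/

section Martingale

variable {S : Type*} [MeasurableSpace S] [Countable S] [MeasurableSingletonClass S] (M : MRP S)

/-- Temporal difference `R_j + V⋆(S_{j+1}) - V⋆(S_j)`. -/
def increment (j : ℕ) (w : StatePath S) : ℝ := (w j).2 + M.V (w (j + 1)).1 - M.V (w j).1

theorem measurable_increment_path (j : ℕ) : Measurable (M.increment j) := by
  have h1 := measurable_comp_state M.V j
  have h2 := measurable_comp_state M.V (j + 1)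
  unfold increment
  fun_prop

theorem abs_increment_path_le {h : ℝ} (hEff : M.EffectiveHorizon h) (hR : M.BoundedRewards)
    {w : StatePath S} (hw : M.IsRegular w) (j : ℕ) : |M.increment j w| ≤ 1 + 2 * |h| := by
  have h1 := abs_le.1 (M.abs_V_le hEff hR (w j).1)
  have h2 := abs_le.1 (M.abs_V_le hEff hR (w (j + 1)).1)
  have h3 := abs_le.1 (hw.2 j).1
  rw [increment, abs_le]
  constructor <;> linarith

theorem increment_eq_zero {w : StatePath S} (hw : M.IsRegular w) {j : ℕ} (hj : M.len w ≤ j) :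
    M.increment j w = 0 := by
  have h := (hw.term_iff j).2 hj
  have h' := (hw.2 j).2 h
  simp [increment, h, h', V_term]

variable {M}

section Predictable

variable {h : ℝ} (ρ : Measure S) [IsProbabilityMeasure ρ]

/-- The condition `φ (past j w) = φ w` expresses predictability: `φ` may use `S_0, …, S_j` and `R_0,
…, R_{j-1}`, but neither `R_j` nor `S_{j+1}`. The temporal difference has mean zero given this
information. -/
theorem integral_mul_increment (hEff : M.EffectiveHorizon h) (hR : M.BoundedRewards) {j : ℕ}
    {φ : StatePath S → ℝ} (hm : Measurable φ) (hp : ∀ w, φ (past j w) = φ w) {c : ℝ}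
    (hc : ∀ᵐ w ∂M.pathLaw ρ, |φ w| ≤ c) :
    Integrable (fun w => φ w * M.increment j w) (M.pathLaw ρ) ∧
      ∫ w, φ w * M.increment j w ∂M.pathLaw ρ = 0 := by
  have hi : Integrable (fun w => φ w * M.increment j w) (M.pathLaw ρ) := by
    refine integrable_of_abs_le (hm.mul (M.measurable_increment_path j))
      (c := c * (1 + 2 * |h|)) ?_
    filter_upwards [hc, M.ae_isRegular hEff hR ρ] with w h1 h2
    rw [abs_mul]
    exact mul_le_mul h1 (M.abs_increment_path_le hEff hR h2 j) (abs_nonneg _)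
      ((abs_nonneg _).trans h1)
  refine ⟨hi, ?_⟩
  have hV : Measurable M.V := Measurable.of_discrete
  have hs (w : StatePath S) : (past j w j).1 = (w j).1 := by simp [past]
  have key := M.integral_past ρ j
    (F := fun q => φ q.1 * (q.2.1 + M.V q.2.2 - M.V (q.1 j).1)) (by fun_prop)
    (by simpa only [hp, hs, increment] using hi)
  simp only [hp, hs, integral_const_mul, M.integral_increment hEff hR, mul_zero,
    integral_zero] at key
  exact key

theorem integral_mul_increment_sq (hEff : M.EffectiveHorizon h) (hR : M.BoundedRewards) {j : ℕ}
    {φ : StatePath S → ℝ} (hm : Measurable φ) (hp : ∀ w, φ (past j w) = φ w) {c : ℝ}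
    (hc : ∀ᵐ w ∂M.pathLaw ρ, |φ w| ≤ c) :
    Integrable (fun w => φ w * M.increment j w ^ 2) (M.pathLaw ρ) ∧
      ∫ w, φ w * M.increment j w ^ 2 ∂M.pathLaw ρ =
        ∫ w, φ w * M.oneStepVar (w j).1 ∂M.pathLaw ρ := by
  have hi : Integrable (fun w => φ w * M.increment j w ^ 2) (M.pathLaw ρ) := by
    refine integrable_of_abs_le (hm.mul ((M.measurable_increment_path j).pow_const 2))
      (c := c * (1 + 2 * |h|) ^ 2) ?_
    filter_upwards [hc, M.ae_isRegular hEff hR ρ] with w h1 h2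
    rw [abs_mul, abs_pow]
    have := M.abs_increment_path_le hEff hR h2 j
    have := (abs_nonneg _).trans h1
    gcongr
  refine ⟨hi, ?_⟩
  have hV : Measurable M.V := Measurable.of_discrete
  have hs (w : StatePath S) : (past j w j).1 = (w j).1 := by simp [past]
  have key := M.integral_past ρ j
    (F := fun q => φ q.1 * (q.2.1 + M.V q.2.2 - M.V (q.1 j).1) ^ 2) (by fun_prop)
    (by simpa only [hp, hs, increment] using hi)
  simp only [hp, hs, integral_const_mul, ← M.oneStepVar_eq hEff hR] at key
  exact key

variable {H : ℕ → StatePath S → ℝ} {c : ℝ}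

/-- The last increment, at time `J - 1`, needs `S_J` but not `R_J`. This is why `past J` retains the
state at time `J` and erases only the reward. -/
theorem partialSum_past (hp : ∀ j w, H j (past j w) = H j w)
    (J : ℕ) (w : StatePath S) :
    ∑ j ∈ Finset.range J, H j (past J w) * M.increment j (past J w) =
      ∑ j ∈ Finset.range J, H j w * M.increment j w := by
  refine Finset.sum_congr rfl fun j hj => ?_
  have hj := Finset.mem_range.1 hj
  have h1 : past j (past J w) = past j w := by
    ext i <;> simp only [past] <;> split_ifs <;> first | rfl | omega
  have h2 : M.increment j (past J w) = M.increment j w := by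
    have : (past J w (j + 1)).1 = (w (j + 1)).1 := by
      simp only [past]; split_ifs with hlt
      · rfl
      · rw [show J = j + 1 by omega]
    have h3 : past J w j = w j := by simp [past, hj]
    simp [increment, this, h3]
  rw [h2, ← hp j (past J w), h1, hp]

/-- At most `len` increments are nonzero and their weights are at most `c * len`. The bound does not
depend on `J`, so it serves for dominated convergence. -/
theorem abs_partialSum_le (hEff : M.EffectiveHorizon h) (hR : M.BoundedRewards)
    (hb : ∀ j w, |H j w| ≤ c * (j + 1)) {w : StatePath S}
    (hw : M.IsRegular w) (J : ℕ) :
    |∑ j ∈ Finset.range J, H j w * M.increment j w| ≤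
      (c * (1 + 2 * |h|)) * (M.len w : ℝ) ^ 2 := by
  have hc : 0 ≤ c := by simpa using (abs_nonneg _).trans (hb 0 w)
  have hterm (j : ℕ) : |H j w * M.increment j w| ≤
      if j < M.len w then c * (1 + 2 * |h|) * M.len w else 0 := by
    split_ifs with hj
    · have h1 := M.abs_increment_path_le hEff hR hw j
      have h2 : (j : ℝ) + 1 ≤ M.len w := by exact_mod_cast hj
      rw [abs_mul]
      calc _ ≤ (c * (j + 1)) * (1 + 2 * |h|) := by
            gcongr
            exact hb j w
        _ ≤ (c * M.len w) * (1 + 2 * |h|) := by gcongr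
        _ = _ := by ring
    · simp [M.increment_eq_zero hw (not_lt.1 hj)]
  calc _ ≤ ∑ j ∈ Finset.range J, |H j w * M.increment j w| := Finset.abs_sum_le_sum_abs _ _
    _ ≤ ∑ j ∈ Finset.range J, if j < M.len w then c * (1 + 2 * |h|) * M.len w else 0 :=
        Finset.sum_le_sum fun j _ => hterm j
    _ ≤ ∑ j ∈ Finset.range (M.len w), c * (1 + 2 * |h|) * M.len w := by
        rw [← Finset.sum_filter]
        refine Finset.sum_le_sum_of_subset_of_nonneg (fun j hj => ?_) fun _ _ _ => by positivity
        simpa using (Finset.mem_filter.1 hj).2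
    _ = _ := by simp; ring

theorem partialSum_eventuallyEq {w : StatePath S} (hw : M.IsRegular w) {J : ℕ}
    (hJ : M.len w ≤ J) :
    ∑ j ∈ Finset.range J, H j w * M.increment j w =
      ∑ j ∈ Finset.range (M.len w), H j w * M.increment j w := by
  symm
  refine Finset.sum_subset (by simpa using hJ) fun j _ hj => ?_
  rw [M.increment_eq_zero hw (by simpa using hj), mul_zero]

theorem integral_add_three {α : Type*} [MeasurableSpace α] {μ : Measure α} {f g k : α → ℝ}
    (hf : Integrable f μ) (hg : Integrable g μ) (hk : Integrable k μ) :
    ∫ x, f x + g x + k x ∂μ = ∫ x, f x ∂μ + ∫ x, g x ∂μ + ∫ x, k x ∂μ := by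
  rw [integral_add (f := fun x => f x + g x) (hf.add hg) hk, integral_add hf hg]

/-- Orthogonality of martingale increments: when the sum is extended by one term, the cross term has
a predictable coefficient and integrates to zero. -/
theorem integral_partialSum_sq (hEff : M.EffectiveHorizon h) (hR : M.BoundedRewards)
    (hm : ∀ j, Measurable (H j)) (hp : ∀ j w, H j (past j w) = H j w)
    (hb : ∀ j w, |H j w| ≤ c * (j + 1)) (J : ℕ) :
    ∫ w, (∑ j ∈ Finset.range J, H j w * M.increment j w) ^ 2 ∂M.pathLaw ρ =
      ∑ j ∈ Finset.range J, ∫ w, H j w ^ 2 * M.oneStepVar (w j).1 ∂M.pathLaw ρ := by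
  have hreg := M.ae_isRegular hEff hR ρ
  induction J with
  | zero => simp
  | succ J ih =>
    set Y : StatePath S → ℝ := fun w => ∑ j ∈ Finset.range J, H j w * M.increment j w with hY
    have hYm : Measurable Y :=
      Finset.measurable_fun_sum _ fun j _ => (hm j).mul (M.measurable_increment_path j)
    have hYp (w : StatePath S) : Y (past J w) = Y w := partialSum_past hp J w
    clear_value Y
    obtain ⟨d, hd⟩ : ∃ d, ∀ᵐ w ∂M.pathLaw ρ, |Y w| ≤ d := by
      refine ⟨∑ j ∈ Finset.range J, (c * (j + 1)) * (1 + 2 * |h|), ?_⟩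
      filter_upwards [hreg] with w hw
      rw [hY]
      refine (Finset.abs_sum_le_sum_abs _ _).trans (Finset.sum_le_sum fun j _ => ?_)
      rw [abs_mul]
      exact mul_le_mul (hb j w) (M.abs_increment_path_le hEff hR hw j) (abs_nonneg _)
        ((abs_nonneg _).trans (hb j w))
    have i1 : Integrable (fun w => Y w ^ 2) (M.pathLaw ρ) := by
      refine integrable_of_abs_le (hYm.pow_const 2) (c := d ^ 2) ?_
      filter_upwards [hd] with w hw
      rw [abs_pow]
      gcongr
    have i2 := integral_mul_increment ρ hEff hR (φ := fun w => 2 * (Y w * H J w)) (j := J)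
      ((hYm.mul (hm J)).const_mul 2) (fun w => by rw [hp, hYp])
      (c := 2 * (d * (c * (J + 1)))) (by
        filter_upwards [hd] with w hw
        rw [abs_mul, abs_mul, abs_two]
        have := (abs_nonneg _).trans hw
        gcongr
        exact hb J w)
    have i3 := integral_mul_increment_sq ρ hEff hR (φ := fun w => H J w ^ 2) (j := J)
      ((hm J).pow_const 2) (fun w => by rw [hp]) (c := (c * (J + 1)) ^ 2) (by
        filter_upwards with w
        rw [abs_pow]
        gcongr
        exact hb J w)
    rw [Finset.sum_range_succ, ← ih, ← i3.2]
    have hexp : (fun w => (∑ j ∈ Finset.range (J + 1), H j w * M.increment j w) ^ 2) =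
        fun w => Y w ^ 2 + 2 * (Y w * H J w) * M.increment J w +
          H J w ^ 2 * M.increment J w ^ 2 := by
      funext w
      rw [Finset.sum_range_succ, hY]
      ring
    rw [hexp, integral_add_three i1 i2.1 i3.1, i2.2, add_zero, hY]

/-- Mean and second moment of a martingale transform of the temporal differences, stopped at the
end of the trajectory. -/
theorem martingaleTransform (hEff : M.EffectiveHorizon h) (hR : M.BoundedRewards)
    (hm : ∀ j, Measurable (H j)) (hp : ∀ j w, H j (past j w) = H j w)
    (hb : ∀ j w, |H j w| ≤ c * (j + 1)) :
    MemLp (fun w => ∑ j ∈ Finset.range (M.len w), H j w * M.increment j w) 2 (M.pathLaw ρ) ∧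
    ∫ w, ∑ j ∈ Finset.range (M.len w), H j w * M.increment j w ∂M.pathLaw ρ = 0 ∧
    HasSum (fun j => ∫ w, H j w ^ 2 * M.oneStepVar (w j).1 ∂M.pathLaw ρ)
      (∫ w, (∑ j ∈ Finset.range (M.len w), H j w * M.increment j w) ^ 2 ∂M.pathLaw ρ) := by
  set X : StatePath S → ℝ := fun w => ∑ j ∈ Finset.range (M.len w), H j w * M.increment j w
    with hX
  set Y : ℕ → StatePath S → ℝ := fun J w => ∑ j ∈ Finset.range J, H j w * M.increment j w with hY
  set K := c * (1 + 2 * |h|)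
  have hreg := M.ae_isRegular hEff hR ρ
  have hinc (j : ℕ) := M.measurable_increment_path j
  have hXm : Measurable X := M.measurable_sum_len fun j => (hm j).mul (hinc j)
  have hYm (J : ℕ) : Measurable (Y J) :=
    Finset.measurable_fun_sum _ fun j _ => (hm j).mul (hinc j)
  have hYb (J : ℕ) : ∀ᵐ w ∂M.pathLaw ρ, |Y J w| ≤ K * (M.len w : ℝ) ^ 2 :=
    hreg.mono fun w hw => abs_partialSum_le hEff hR hb hw J
  have hYX : ∀ᵐ w ∂M.pathLaw ρ, ∀ᶠ J in atTop, Y J w = X w :=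
    hreg.mono fun w hw => (eventually_ge_atTop (M.len w)).mono fun J hJ =>
      partialSum_eventuallyEq hw hJ
  have hXb : ∀ᵐ w ∂M.pathLaw ρ, |X w| ≤ K * (M.len w : ℝ) ^ 2 :=
    hreg.mono fun w hw => abs_partialSum_le hEff hR hb hw _
  have hK2 : Integrable (fun w => K * (M.len w : ℝ) ^ 2) (M.pathLaw ρ) :=
    (M.integrable_len_pow hEff ρ 2).const_mul K
  -- The transform is bounded by a multiple of `len ^ 2`, so its square requires the fourth moment
  -- of the length.
  have hK4 : Integrable (fun w => (K * (M.len w : ℝ) ^ 2) ^ 2) (M.pathLaw ρ) := by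
    refine ((M.integrable_len_pow hEff ρ 4).const_mul (K ^ 2)).congr (ae_of_all _ fun w => ?_)
    ring
  have hHb (j : ℕ) : ∀ᵐ w ∂M.pathLaw ρ, |H j w| ≤ c * (j + 1) := ae_of_all _ (hb j)
  have hmean (J : ℕ) : ∫ w, Y J w ∂M.pathLaw ρ = 0 := by
    rw [hY, integral_finsetSum _ fun j _ =>
      (integral_mul_increment ρ hEff hR (hm j) (hp j) (hHb j)).1]
    exact Finset.sum_eq_zero fun j _ =>
      (integral_mul_increment ρ hEff hR (hm j) (hp j) (hHb j)).2
  have hsq (J : ℕ) : ∫ w, Y J w ^ 2 ∂M.pathLaw ρ =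
      ∑ j ∈ Finset.range J, ∫ w, H j w ^ 2 * M.oneStepVar (w j).1 ∂M.pathLaw ρ :=
    integral_partialSum_sq ρ hEff hR hm hp hb J
  refine ⟨?_, ?_, ?_⟩
  · rw [memLp_two_iff_integrable_sq hXm.aestronglyMeasurable]
    refine hK4.mono (hXm.pow_const 2).aestronglyMeasurable ?_
    filter_upwards [hXb] with w hw
    rw [Real.norm_eq_abs, Real.norm_eq_abs, abs_pow, abs_pow]
    exact pow_le_pow_left₀ (abs_nonneg _) (hw.trans (le_abs_self _)) 2
  · refine tendsto_nhds_unique (tendsto_integral_of_dominated_convergence _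
      (fun J => (hYm J).aestronglyMeasurable) hK2 hYb ?_)
      (f := fun J => ∫ w, Y J w ∂M.pathLaw ρ) (l := atTop) (by simp [hmean])
    filter_upwards [hYX] with w hw
    exact tendsto_const_nhds.congr' (hw.mono fun _ h => h.symm)
  · rw [hasSum_iff_tendsto_nat_of_nonneg]
    · simp_rw [← hsq]
      refine tendsto_integral_of_dominated_convergence _
        (fun J => ((hYm J).pow_const 2).aestronglyMeasurable) hK4 (fun J => ?_) ?_
      · filter_upwards [hYb J] with w hw
        rw [Real.norm_eq_abs, abs_pow]
        gcongr
      · filter_upwards [hYX] with w hw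
        exact tendsto_const_nhds.congr' (hw.mono fun J h => congrArg (· ^ 2) h.symm)
    · exact fun j => integral_nonneg fun w => mul_nonneg (sq_nonneg _) (M.oneStepVar_nonneg _)

end Predictable

end Martingale

end MRP

namespace MRP

/-! ### The covariances as inner products of visit and exit counts. -/

section Energy

variable {S : Type*} [MeasurableSpace S] [Countable S] [MeasurableSingletonClass S] (M : MRP S)

open Classical in
/-- `1{S_j = s}`. -/
def visit (s : S) (j : ℕ) (w : StatePath S) : ℕ := if (w j).1 = s then 1 else 0

open Classical in
/-- `1{S_t = s, S_{t+1} ∉ G}`. -/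
def exitAt (G : Finset S) (s : S) (t : ℕ) (w : StatePath S) : ℕ :=
  if (w t).1 = s ∧ (w (t + 1)).1 ∉ G then 1 else 0

/-- Number of direct exits from `G` through `s` strictly before time `j`. -/
def exits (G : Finset S) (s : S) (j : ℕ) (w : StatePath S) : ℕ :=
  ∑ t ∈ Finset.range j, exitAt G s t w

theorem measurable_visit (s : S) (j : ℕ) : Measurable (visit s j) := by
  classical
  exact measurable_comp_state (fun x => if x = s then 1 else 0) j

theorem measurable_exitAt (G : Finset S) (s : S) (t : ℕ) : Measurable (exitAt G s t) := by
  classical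
  have h : Measurable fun p : S × S => if p.1 = s ∧ p.2 ∉ G then 1 else 0 :=
    Measurable.of_discrete
  exact h.comp (g := fun p : S × S => if p.1 = s ∧ p.2 ∉ G then 1 else 0)
    (f := fun w : StatePath S => ((w t).1, (w (t + 1)).1)) (by fun_prop)

theorem measurable_exits (G : Finset S) (s : S) (j : ℕ) : Measurable (exits G s j) :=
  Finset.measurable_fun_sum _ fun t _ => measurable_exitAt G s t

theorem visit_le (s : S) (j : ℕ) (w : StatePath S) : visit s j w ≤ 1 := by
  unfold visit; split_ifs <;> simp

theorem exits_le (G : Finset S) (s : S) (j : ℕ) (w : StatePath S) : exits G s j w ≤ j := by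
  refine (Finset.sum_le_card_nsmul _ _ 1 fun t _ => ?_).trans (by simp)
  unfold exitAt; split_ifs <;> simp

theorem visit_past (s : S) (j : ℕ) (w : StatePath S) : visit s j (past j w) = visit s j w := by
  have hs : (past j w j).1 = (w j).1 := by simp [past]
  rw [visit, visit, hs]

/-- An exit at a time `t < j` is decided by `S_t` and `S_{t+1}`, and `t + 1 ≤ j`, so the count
strictly before `j` is predictable. -/
theorem exits_past (G : Finset S) (s : S) (j : ℕ) (w : StatePath S) :
    exits G s j (past j w) = exits G s j w := by
  refine Finset.sum_congr rfl fun t ht => ?_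
  have ht := Finset.mem_range.1 ht
  have h1 : (past j w (t + 1)).1 = (w (t + 1)).1 := by
    simp only [past]; split_ifs with hlt
    · rfl
    · rw [show j = t + 1 by omega]
  have h2 : past j w t = w t := by simp [past, ht]
  rw [exitAt, exitAt, h1, h2]

/-- The measure `∑_j δ_j ⊗ σ²(S_j) P_μ` on pairs of a time and a trajectory. -/
def energy : Measure (ℕ × StatePath S) :=
  (Measure.count.prod M.law).withDensity fun p => ENNReal.ofReal (M.oneStepVar (p.2 p.1).1)

theorem measurable_uncurry_time {β : Type*} [MeasurableSpace β] {F : ℕ → StatePath S → β}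
    (hF : ∀ j, Measurable (F j)) : Measurable fun p : ℕ × StatePath S => F p.1 p.2 :=
  measurable_from_prod_countable_right hF

theorem lintegral_energy {F : ℕ → StatePath S → ℝ≥0∞} (hF : ∀ j, Measurable (F j)) :
    ∫⁻ p, F p.1 p.2 ∂M.energy =
      ∑' j, ∫⁻ w, F j w * ENNReal.ofReal (M.oneStepVar (w j).1) ∂M.law := by
  have hd : Measurable fun p : ℕ × StatePath S => ENNReal.ofReal (M.oneStepVar (p.2 p.1).1) :=
    measurable_uncurry_time (F := fun j w => ENNReal.ofReal (M.oneStepVar (w j).1))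
      fun j => measurable_comp_state (fun s => ENNReal.ofReal (M.oneStepVar s)) j
  have hF' := measurable_uncurry_time hF
  rw [energy, lintegral_withDensity_eq_lintegral_mul _ hd hF',
    lintegral_prod _ (hd.mul hF').aemeasurable, lintegral_count]
  simp [mul_comm]

theorem tsum_law_state {A : Set (StatePath S)} (hA : MeasurableSet A) (j : ℕ) (c : S → ℝ≥0∞) :
    ∑' s, M.law (A ∩ {w | (w j).1 = s}) * c s = ∫⁻ w, A.indicator (fun w => c (w j).1) w ∂M.law := by
  classical
  have hm (s : S) : MeasurableSet (A ∩ {w : StatePath S | (w j).1 = s}) :=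
    hA.inter (measurableSet_state {s} j)
  have h1 (w : StatePath S) : A.indicator (fun w => c (w j).1) w =
      ∑' s, (A ∩ {w : StatePath S | (w j).1 = s}).indicator (fun _ => c s) w := by
    rw [tsum_eq_single (w j).1]
    · by_cases hw : w ∈ A <;> simp [hw]
    · intro s hs
      simp [Ne.symm hs]
  simp_rw [h1]
  rw [lintegral_tsum fun s => (measurable_const.indicator (hm s)).aemeasurable]
  refine tsum_congr fun s => ?_
  rw [lintegral_indicator_const (hm s), mul_comm]

theorem measurable_var (j : ℕ) :
    Measurable fun w : StatePath S => ENNReal.ofReal (M.oneStepVar (w j).1) :=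
  measurable_comp_state (fun s => ENNReal.ofReal (M.oneStepVar s)) j

theorem law_mul_var {A : Set (StatePath S)} (hA : MeasurableSet A) {j : ℕ} {s : S}
    (hs : ∀ w ∈ A, (w j).1 = s) {f : StatePath S → ℕ} (hf : ∀ w, f w = A.indicator 1 w) :
    M.law A * ENNReal.ofReal (M.oneStepVar s) =
      ∫⁻ w, f w * ENNReal.ofReal (M.oneStepVar (w j).1) ∂M.law := by
  rw [mul_comm, ← lintegral_indicator_const hA]
  refine lintegral_congr fun w => ?_
  by_cases hw : w ∈ A
  · simp [hf, hw, hs w hw]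
  · simp [hf, hw]

-- A trajectory is in only one state at time `j`, so visits to different states are orthogonal. This
-- gives the diagonal part of `Λ⋆`.
open Classical in
theorem lintegral_visit_visit (s s' : S) :
    ∫⁻ p, ((visit s p.1 p.2 * visit s' p.1 p.2 : ℕ) : ℝ≥0∞) ∂M.energy =
      if s = s' then ∑' t : ℕ, M.law {w | (w t).1 = s} * ENNReal.ofReal (M.oneStepVar s) else 0 := by
  have hm (j : ℕ) : Measurable fun w => ((visit s j w * visit s' j w : ℕ) : ℝ≥0∞) :=
    (Measurable.of_discrete (f := fun n : ℕ => (n : ℝ≥0∞))).comp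
      ((measurable_visit s j).mul (measurable_visit s' j))
  rw [lintegral_energy M hm]
  split_ifs with h
  · subst h
    refine tsum_congr fun t => (M.law_mul_var (measurableSet_state {s} t) (fun w hw => hw)
      fun w => ?_).symm
    by_cases hw : (w t).1 = s <;> simp [visit, hw]
  · refine ENNReal.tsum_eq_zero.2 fun j => ?_
    refine lintegral_eq_zero_of_ae_eq_zero (ae_of_all _ fun w => ?_)
    by_cases hw : (w j).1 = s
    · simp [visit, hw, h]
    · simp [visit, hw]

theorem lintegral_visit_exits (G : Finset S) (s s' : S) :
    ∫⁻ p, ((visit s p.1 p.2 * exits G s' p.1 p.2 : ℕ) : ℝ≥0∞) ∂M.energy = M.crossSum G s s' := by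
  have hc : Measurable fun n : ℕ => (n : ℝ≥0∞) := Measurable.of_discrete
  rw [lintegral_energy M (F := fun j w => ((visit s j w * exits G s' j w : ℕ) : ℝ≥0∞)) fun j =>
    hc.comp ((measurable_visit s j).mul (measurable_exits G s' j))]
  refine tsum_congr fun j => ?_
  simp_rw [exits, Finset.mul_sum, Nat.cast_sum, Finset.sum_mul]
  have hmm (t : ℕ) : Measurable fun w => ((visit s j w * exitAt G s' t w : ℕ) : ℝ≥0∞) *
      ENNReal.ofReal (M.oneStepVar (w j).1) :=
    (hc.comp ((measurable_visit s j).mul (measurable_exitAt G s' t))).mul (M.measurable_var j)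
  rw [lintegral_finsetSum _ fun t _ => hmm t]
  refine Finset.sum_congr rfl fun t _ => (M.law_mul_var ?_ (fun w hw => hw.2.2) fun w => ?_).symm
  · exact (measurableSet_state {s'} t).inter ((measurableSet_state {x | x ∉ G} (t + 1)).inter
      (measurableSet_state {s} j))
  · by_cases h1 : (w t).1 = s' <;> by_cases h2 : (w (t + 1)).1 ∈ G <;>
      by_cases h3 : (w j).1 = s <;> simp [visit, exitAt, h1, h2, h3]

/-- The two exit counts before `j` expand into pairs `t, t' < j`, which is the condition `max t t' +
1 ≤ j`. Tonelli moves the sum over `j` inside, and `tsum_law_state` splits the variance according to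
the state at time `j`. -/
theorem lintegral_exits_exits (G : Finset S) (s s' : S) :
    ∫⁻ p, ((exits G s p.1 p.2 * exits G s' p.1 p.2 : ℕ) : ℝ≥0∞) ∂M.energy = M.exitSum G s s' := by
  classical
  have hc : Measurable fun n : ℕ => (n : ℝ≥0∞) := Measurable.of_discrete
  rw [lintegral_energy M (F := fun j w => ((exits G s j w * exits G s' j w : ℕ) : ℝ≥0∞)) fun j =>
    hc.comp ((measurable_exits G s j).mul (measurable_exits G s' j))]
  let I (t t' j : ℕ) : ℝ≥0∞ := ∫⁻ w, ((exitAt G s t w * exitAt G s' t' w : ℕ) : ℝ≥0∞) *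
    ENNReal.ofReal (M.oneStepVar (w j).1) ∂M.law
  have hL (j : ℕ) : ∫⁻ w, ((exits G s j w * exits G s' j w : ℕ) : ℝ≥0∞) *
      ENNReal.ofReal (M.oneStepVar (w j).1) ∂M.law =
      ∑' t, ∑' t', if max t t' + 1 ≤ j then I t t' j else 0 := by
    have hmm (t t' : ℕ) : Measurable fun w => ((exitAt G s t w * exitAt G s' t' w : ℕ) : ℝ≥0∞) *
        ENNReal.ofReal (M.oneStepVar (w j).1) :=
      (hc.comp ((measurable_exitAt G s t).mul (measurable_exitAt G s' t'))).mul (M.measurable_var j)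
    simp_rw [exits, Finset.sum_mul_sum, Nat.cast_sum, Finset.sum_mul]
    rw [lintegral_finsetSum _ fun t _ => Finset.measurable_fun_sum _ fun t' _ => hmm t t']
    rw [tsum_eq_sum (s := Finset.range j)]
    · refine Finset.sum_congr rfl fun t ht => ?_
      rw [lintegral_finsetSum _ fun t' _ => hmm t t', tsum_eq_sum (s := Finset.range j)]
      · refine Finset.sum_congr rfl fun t' ht' => ?_
        rw [if_pos]
        simp only [Finset.mem_range] at ht ht'
        omega
      · intro t' ht'
        rw [if_neg]
        simp only [Finset.mem_range] at ht'
        omega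
    · intro t ht
      refine ENNReal.tsum_eq_zero.2 fun t' => ?_
      rw [if_neg]
      simp only [Finset.mem_range] at ht
      omega
  simp_rw [hL]
  rw [ENNReal.tsum_comm]
  refine tsum_congr fun t => ?_
  rw [ENNReal.tsum_comm]
  refine tsum_congr fun t' => ?_
  have hsub := tsum_subtype {j : ℕ | max t t' + 1 ≤ j} (fun j => I t t' j)
  simp only [Set.indicator_apply, Set.mem_ofPred_eq] at hsub
  refine hsub.symm.trans (tsum_congr fun j => ?_)
  have hA : MeasurableSet {w : StatePath S | (w t).1 = s ∧ (w t').1 = s' ∧ (w (t' + 1)).1 ∉ G ∧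
      (w (t + 1)).1 ∉ G} :=
    (measurableSet_state {s} t).inter ((measurableSet_state {s'} t').inter
      ((measurableSet_state {x | x ∉ G} (t' + 1)).inter (measurableSet_state {x | x ∉ G} (t + 1))))
  have hset (s'' : S) : {w : StatePath S | (w t).1 = s ∧ (w t').1 = s' ∧ (w (t' + 1)).1 ∉ G ∧
      (w (t + 1)).1 ∉ G ∧ (w j).1 = s''} = {w : StatePath S | (w t).1 = s ∧ (w t').1 = s' ∧
      (w (t' + 1)).1 ∉ G ∧ (w (t + 1)).1 ∉ G} ∩ {w | (w j).1 = s''} := by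
    ext w; simp [and_assoc]
  simp_rw [hset]
  rw [M.tsum_law_state hA j fun s => ENNReal.ofReal (M.oneStepVar s)]
  refine lintegral_congr fun w => ?_
  by_cases h1 : (w t).1 = s <;> by_cases h2 : (w t').1 = s' <;>
    by_cases h3 : (w (t + 1)).1 ∈ G <;> by_cases h4 : (w (t' + 1)).1 ∈ G <;>
    simp [exitAt, h1, h2, h3, h4]

/-- The weight of the temporal difference at time `j` in the error at `s`. -/
def weight (G : Finset S) (s : S) (j : ℕ) (w : StatePath S) : ℕ := visit s j w + exits G s j w

theorem measurable_weight (G : Finset S) (s : S) (j : ℕ) : Measurable (weight G s j) :=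
  (measurable_visit s j).add (measurable_exits G s j)

theorem weight_past (G : Finset S) (s : S) (j : ℕ) (w : StatePath S) :
    weight G s j (past j w) = weight G s j w := by
  simp [weight, visit_past, exits_past]

theorem weight_le (G : Finset S) (s : S) (j : ℕ) (w : StatePath S) : weight G s j w ≤ j + 1 := by
  have := visit_le s j w
  have := exits_le G s j w
  unfold weight; omega

/-- Expanding `(visit + exits) * (visit' + exits')` produces the diagonal term, the two cross sums
and the exit sum. -/
theorem lintegral_weight_weight (G : Finset S) (s s' : S) :
    ∫⁻ p, ((weight G s p.1 p.2 * weight G s' p.1 p.2 : ℕ) : ℝ≥0∞) ∂M.energy =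
      M.lambdaG G s s' := by
  classical
  have hc : Measurable fun n : ℕ => (n : ℝ≥0∞) := Measurable.of_discrete
  have hv (s : S) := measurable_uncurry_time (measurable_visit s)
  have he (s : S) := measurable_uncurry_time (measurable_exits G s)
  have hexp (p : ℕ × StatePath S) :
      ((weight G s p.1 p.2 * weight G s' p.1 p.2 : ℕ) : ℝ≥0∞) =
      ((visit s p.1 p.2 * visit s' p.1 p.2 : ℕ) : ℝ≥0∞) +
      (((visit s p.1 p.2 * exits G s' p.1 p.2 : ℕ) : ℝ≥0∞) +
        ((visit s' p.1 p.2 * exits G s p.1 p.2 : ℕ) : ℝ≥0∞)) +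
      ((exits G s p.1 p.2 * exits G s' p.1 p.2 : ℕ) : ℝ≥0∞) := by
    unfold weight; push_cast; ring
  simp_rw [hexp]
  have hee : Measurable fun p : ℕ × StatePath S =>
      ((exits G s p.1 p.2 * exits G s' p.1 p.2 : ℕ) : ℝ≥0∞) := hc.comp ((he s).mul (he s'))
  have hve (s s' : S) : Measurable fun p : ℕ × StatePath S =>
      ((visit s p.1 p.2 * exits G s' p.1 p.2 : ℕ) : ℝ≥0∞) := hc.comp ((hv s).mul (he s'))
  have hcross : Measurable fun p : ℕ × StatePath S =>
      ((visit s p.1 p.2 * exits G s' p.1 p.2 : ℕ) : ℝ≥0∞) +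
        ((visit s' p.1 p.2 * exits G s p.1 p.2 : ℕ) : ℝ≥0∞) := (hve s s').add (hve s' s)
  rw [lintegral_add_right _ hee, lintegral_add_right _ hcross,
    lintegral_add_right _ (hve s' s),
    lintegral_visit_visit, lintegral_visit_exits, lintegral_visit_exits, lintegral_exits_exits]
  rw [lambdaG]

/-- Along a trajectory `σ²(S_j)` vanishes from time `len` on, so the sum of `(j + 1)² σ²(S_j)` is at
most a constant times `len ^ 3`. Weights grow at most linearly in time, hence all products of two
weights are integrable. -/
theorem lintegral_time_sq_lt_top {h : ℝ} (hEff : M.EffectiveHorizon h) (hR : M.BoundedRewards) :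
    ∫⁻ p, (((p.1 + 1) ^ 2 : ℕ) : ℝ≥0∞) ∂M.energy < ∞ := by
  rw [lintegral_energy M (F := fun j _ => (((j + 1) ^ 2 : ℕ) : ℝ≥0∞)) fun j => measurable_const,
    ← lintegral_tsum fun j => ((M.measurable_var j).const_mul _).aemeasurable]
  have hb : ∫⁻ w, ENNReal.ofReal ((1 + 2 * |h|) ^ 2) * (M.len w : ℝ≥0∞) ^ 3 ∂M.law < ∞ := by
    rw [lintegral_const_mul' _ _ ENNReal.ofReal_ne_top]
    exact ENNReal.mul_lt_top ENNReal.ofReal_lt_top (M.lintegral_len_pow hEff M.μ 3)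
  refine lt_of_le_of_lt (lintegral_mono_ae ?_) hb
  filter_upwards [M.ae_isRegular hEff hR M.μ] with w hw
  rw [tsum_eq_sum (s := Finset.range (M.len w))]
  · calc _ ≤ ∑ j ∈ Finset.range (M.len w), (M.len w : ℝ≥0∞) ^ 2 *
        ENNReal.ofReal ((1 + 2 * |h|) ^ 2) := by
          refine Finset.sum_le_sum fun j hj => ?_
          gcongr
          · have : j + 1 ≤ M.len w := Finset.mem_range.1 hj
            exact_mod_cast Nat.pow_le_pow_left this 2
          · refine (M.oneStepVar_le hEff hR _).trans ?_
            have := (le_abs_self _).trans (M.abs_alive_le (w j).1)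
            exact mul_le_of_le_one_right (by positivity) this
      _ = _ := by
          simp only [Finset.sum_const, Finset.card_range, nsmul_eq_mul]
          ring
  · intro j hj
    have h1 : M.alive (w j).1 = 0 := by
      rw [hw.alive_eq, if_neg (by simpa using hj)]
    have h2 := M.oneStepVar_le hEff hR (w j).1
    rw [h1, mul_zero] at h2
    rw [ENNReal.ofReal_of_nonpos h2, mul_zero]

theorem integrable_time_sq {h : ℝ} (hEff : M.EffectiveHorizon h) (hR : M.BoundedRewards) :
    Integrable (fun p : ℕ × StatePath S => ((p.1 : ℝ) + 1) ^ 2) M.energy := by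
  refine ⟨Measurable.aestronglyMeasurable ?_, ?_⟩
  · exact (Measurable.of_discrete (f := fun n : ℕ => ((n : ℝ) + 1) ^ 2)).comp measurable_fst
  · refine lt_of_eq_of_lt (lintegral_congr fun p => ?_) (M.lintegral_time_sq_lt_top hEff hR)
    have : ((p.1 : ℝ) + 1) ^ 2 = (((p.1 + 1) ^ 2 : ℕ) : ℝ) := by push_cast; ring
    simp only [this, Real.enorm_natCast]

/-- Products of functions that grow at most linearly in time are integrable. -/
theorem integrable_energy_mul {h : ℝ} (hEff : M.EffectiveHorizon h) (hR : M.BoundedRewards)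
    {f g : ℕ → StatePath S → ℝ} (hf : ∀ j, Measurable (f j)) (hg : ∀ j, Measurable (g j))
    {a b : ℝ} (hfa : ∀ j w, |f j w| ≤ a * (j + 1)) (hgb : ∀ j w, |g j w| ≤ b * (j + 1)) :
    Integrable (fun p : ℕ × StatePath S => f p.1 p.2 * g p.1 p.2) M.energy := by
  refine ((M.integrable_time_sq hEff hR).const_mul (a * b)).mono'
    ((measurable_uncurry_time hf).mul (measurable_uncurry_time hg)).aestronglyMeasurable
    (ae_of_all _ fun p => ?_)
  rw [Real.norm_eq_abs, abs_mul]
  calc _ ≤ (a * (p.1 + 1)) * (b * (p.1 + 1)) :=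
        mul_le_mul (hfa _ _) (hgb _ _) (abs_nonneg _) ((abs_nonneg _).trans (hfa p.1 p.2))
    _ = _ := by ring

theorem toReal_lintegral_natCast {α : Type*} [MeasurableSpace α] {μ : Measure α} {f : α → ℕ}
    (hf : Measurable f) : (∫⁻ x, (f x : ℝ≥0∞) ∂μ).toReal = ∫ x, (f x : ℝ) ∂μ := by
  rw [integral_eq_lintegral_of_nonneg_ae (ae_of_all _ fun x => by positivity)]
  · simp
  · exact ((Measurable.of_discrete (f := fun n : ℕ => (n : ℝ))).comp hf).aestronglyMeasurable

end Energy

end MRP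

/-! ### Gram matrices of functions. -/

section Gram

variable {ι α : Type*} [Fintype ι] [MeasurableSpace α] {μ : Measure α} {f : ι → α → ℝ}

theorem dotProduct_integral_mulVec (hf : ∀ i j, Integrable (fun x => f i x * f j x) μ)
    (u : ι → ℝ) :
    u ⬝ᵥ (Matrix.of fun i j => ∫ x, f i x * f j x ∂μ) *ᵥ u = ∫ x, (∑ i, u i * f i x) ^ 2 ∂μ := by
  have h1 (x : α) : (∑ i, u i * f i x) ^ 2 = ∑ i, ∑ j, u i * u j * (f i x * f j x) := by
    rw [sq, Finset.sum_mul_sum]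
    exact Finset.sum_congr rfl fun i _ => Finset.sum_congr rfl fun j _ => by ring
  simp_rw [h1]
  rw [integral_finsetSum _ fun i _ => integrable_finsetSum _ fun j _ => (hf i j).const_mul _]
  simp only [dotProduct, Matrix.mulVec, Matrix.of_apply, Finset.mul_sum]
  refine Finset.sum_congr rfl fun i _ => ?_
  rw [integral_finsetSum _ fun j _ => (hf i j).const_mul _]
  refine Finset.sum_congr rfl fun j _ => ?_
  rw [integral_const_mul]
  ring

theorem posSemidef_integral_mul (hf : ∀ i j, Integrable (fun x => f i x * f j x) μ) :
    (Matrix.of fun i j => ∫ x, f i x * f j x ∂μ).PosSemidef := by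
  refine .of_dotProduct_mulVec_nonneg ?_ fun u => ?_
  · ext i j
    simp [mul_comm]
  · rw [star_trivial, dotProduct_integral_mulVec hf]
    exact integral_nonneg fun x => sq_nonneg _

end Gram

namespace MRP

/-! ### Positive semidefiniteness, occupancies and invertibility of `I - P_G`. -/

section Covariance

variable {S : Type*} [MeasurableSpace S] [Countable S] [MeasurableSingletonClass S] {M : MRP S}
  {h : ℝ}

theorem lambdaG_ne_top (hEff : M.EffectiveHorizon h) (hR : M.BoundedRewards) (G : Finset S)
    (s s' : S) : M.lambdaG G s s' ≠ ∞ := by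
  rw [← lintegral_weight_weight]
  refine (lt_of_le_of_lt (lintegral_mono fun p => ?_)
    (M.lintegral_time_sq_lt_top hEff hR)).ne
  rw [sq, Nat.cast_le]
  exact Nat.mul_le_mul (weight_le G s p.1 p.2) (weight_le G s' p.1 p.2)

theorem toReal_lambdaG (M : MRP S) (G : Finset S) (s s' : S) : (M.lambdaG G s s').toReal =
    ∫ p, (weight G s p.1 p.2 : ℝ) * weight G s' p.1 p.2 ∂M.energy := by
  rw [← lintegral_weight_weight, toReal_lintegral_natCast]
  · simp
  · exact (measurable_uncurry_time (measurable_weight G s)).mul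
      (measurable_uncurry_time (measurable_weight G s'))

theorem toReal_exitSum (M : MRP S) (G : Finset S) (s s' : S) : (M.exitSum G s s').toReal =
    ∫ p, (exits G s p.1 p.2 : ℝ) * exits G s' p.1 p.2 ∂M.energy := by
  rw [← lintegral_exits_exits, toReal_lintegral_natCast]
  · simp
  · exact (measurable_uncurry_time (measurable_exits G s)).mul
      (measurable_uncurry_time (measurable_exits G s'))

open Classical in
theorem integral_visit_visit (M : MRP S) (s s' : S) :
    ∫ p, (visit s p.1 p.2 : ℝ) * visit s' p.1 p.2 ∂M.energy =
      if s = s' then (M.occ s).toReal * M.oneStepVar s else 0 := by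
  have := toReal_lintegral_natCast (μ := M.energy)
    (f := fun p => visit s p.1 p.2 * visit s' p.1 p.2)
    ((measurable_uncurry_time (measurable_visit s)).mul
      (measurable_uncurry_time (measurable_visit s')))
  rw [lintegral_visit_visit] at this
  push_cast at this
  rw [← this]
  split_ifs
  · rw [ENNReal.tsum_mul_right, ENNReal.toReal_mul,
      ENNReal.toReal_ofReal (M.oneStepVar_nonneg s), occ]
  · simp

theorem measurable_natCast_comp {f : StatePath S → ℕ} (hf : Measurable f) :
    Measurable fun w => (f w : ℝ) :=
  (Measurable.of_discrete (f := fun n : ℕ => (n : ℝ))).comp hf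

theorem abs_visit_le (s : S) (j : ℕ) (w : StatePath S) :
    |(visit s j w : ℝ)| ≤ 1 * ((j : ℝ) + 1) := by
  have : (visit s j w : ℝ) ≤ 1 := by exact_mod_cast visit_le s j w
  rw [Nat.abs_cast]
  have : (0 : ℝ) ≤ j := by positivity
  linarith

theorem abs_exits_le (G : Finset S) (s : S) (j : ℕ) (w : StatePath S) :
    |(exits G s j w : ℝ)| ≤ 1 * ((j : ℝ) + 1) := by
  have : (exits G s j w : ℝ) ≤ j := by exact_mod_cast exits_le G s j w
  rw [Nat.abs_cast]
  linarith

theorem abs_weight_le (G : Finset S) (s : S) (j : ℕ) (w : StatePath S) :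
    |(weight G s j w : ℝ)| ≤ 1 * ((j : ℝ) + 1) := by
  rw [Nat.abs_cast, one_mul]
  exact_mod_cast weight_le G s j w

theorem integrable_weight_mul (hEff : M.EffectiveHorizon h) (hR : M.BoundedRewards)
    (G : Finset S) (s s' : S) :
    Integrable (fun p => (weight G s p.1 p.2 : ℝ) * weight G s' p.1 p.2) M.energy :=
  M.integrable_energy_mul hEff hR (f := fun j w => (weight G s j w : ℝ))
    (g := fun j w => (weight G s' j w : ℝ))
    (fun j => measurable_natCast_comp (measurable_weight G s j))
    (fun j => measurable_natCast_comp (measurable_weight G s' j))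
    (abs_weight_le G s) (abs_weight_le G s')

/-- This is the Gram matrix of the functions `weight / ν(s)` in `L²(energy)`. -/
theorem posSemidef_sigmaG (hEff : M.EffectiveHorizon h) (hR : M.BoundedRewards) (G : Finset S) :
    (M.sigmaG G).PosSemidef := by
  convert! posSemidef_integral_mul (μ := M.energy)
    (f := fun (s : G) p => (weight G s p.1 p.2 : ℝ) / (M.occ s).toReal) (fun s s' => ?_) using 1
  · ext s s'
    simp only [sigmaG, Matrix.of_apply, toReal_lambdaG, div_mul_div_comm, integral_div]
  · simp only [div_mul_div_comm]
    exact (integrable_weight_mul hEff hR G s s').div_const _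

/-- The difference is the Gram matrix of `(visit - exits) / ν(s)`, because `weight = visit + exits`
and `2vv' + 2ee' - (v + e)(v' + e') = (v - e)(v' - e')`. -/
theorem posSemidef_two_smul_sub (hEff : M.EffectiveHorizon h) (hR : M.BoundedRewards)
    (G : Finset S) (hν : ∀ s ∈ G, (M.occ s).toReal ≠ 0) :
    ((2 : ℝ) • M.sigmaX G + (2 : ℝ) • M.sigmaY G - M.sigmaG G).PosSemidef := by
  classical
  have hv (s : S) (j : ℕ) : Measurable fun w => (visit s j w : ℝ) :=
    measurable_natCast_comp (measurable_visit s j)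
  have he (s : S) (j : ℕ) : Measurable fun w => (exits G s j w : ℝ) :=
    measurable_natCast_comp (measurable_exits G s j)
  have ivv (s s' : S) := M.integrable_energy_mul hEff hR (hv s) (hv s') (abs_visit_le s)
    (abs_visit_le s')
  have iee (s s' : S) := M.integrable_energy_mul hEff hR (he s) (he s') (abs_exits_le G s)
    (abs_exits_le G s')
  have iww := integrable_weight_mul hEff hR G
  have hexp (s s' : S) (p : ℕ × StatePath S) :
      ((visit s p.1 p.2 : ℝ) - exits G s p.1 p.2) * ((visit s' p.1 p.2 : ℝ) - exits G s' p.1 p.2) =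
      2 * ((visit s p.1 p.2 : ℝ) * visit s' p.1 p.2) +
      2 * ((exits G s p.1 p.2 : ℝ) * exits G s' p.1 p.2) -
      (weight G s p.1 p.2 : ℝ) * weight G s' p.1 p.2 := by
    simp only [weight, Nat.cast_add]; ring
  have iadd (s s' : S) : Integrable (fun p : ℕ × StatePath S =>
      2 * ((visit s p.1 p.2 : ℝ) * visit s' p.1 p.2) +
      2 * ((exits G s p.1 p.2 : ℝ) * exits G s' p.1 p.2)) M.energy :=
    ((ivv s s').const_mul 2).add ((iee s s').const_mul 2)
  convert! posSemidef_integral_mul (μ := M.energy)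
    (f := fun (s : G) (p : ℕ × StatePath S) =>
      ((visit s.1 p.1 p.2 : ℝ) - exits G s.1 p.1 p.2) / (M.occ s).toReal)
    (fun s s' => ?_) using 1
  · ext s s'
    simp only [Matrix.of_apply, div_mul_div_comm, integral_div, hexp]
    rw [integral_sub (iadd s s') (iww s s'),
      integral_add ((ivv s s').const_mul 2) ((iee s s').const_mul 2), integral_const_mul,
      integral_const_mul, integral_visit_visit]
    simp only [Matrix.sub_apply, Matrix.add_apply, Matrix.smul_apply, sigmaX, sigmaY, sigmaG,
      Matrix.of_apply, Matrix.diagonal_apply, smul_eq_mul, toReal_exitSum, toReal_lambdaG,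
      Subtype.ext_iff]
    have := hν s s.2
    split_ifs with hs
    · rw [← hs]; field_simp
    · ring
  · simp only [div_mul_div_comm, hexp]
    exact ((iadd s s').sub (iww s s')).div_const _

/-- `∑_{t < T} 1{S_t = s} g(S_{t+1})` has mean `ν(s) ∫ g dP(s)`. -/
theorem integral_sum_visit (hEff : M.EffectiveHorizon h) (hR : M.BoundedRewards) {s : S}
    (hs : s ≠ M.term) {g : S → ℝ} (hg : ∀ x, |g x| ≤ 1) :
    Integrable (fun w => ∑ t ∈ Finset.range (M.len w), (visit s t w : ℝ) * g (w (t + 1)).1) M.law ∧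
    ∫ w, ∑ t ∈ Finset.range (M.len w), (visit s t w : ℝ) * g (w (t + 1)).1 ∂M.law =
      (M.occ s).toReal * ∫ x, g x ∂M.P s := by
  have hm (t : ℕ) : Measurable fun w : StatePath S => (visit s t w : ℝ) * g (w (t + 1)).1 :=
    (measurable_natCast_comp (measurable_visit s t)).mul (measurable_comp_state g (t + 1))
  have hle (t : ℕ) (w : StatePath S) :
      |(visit s t w : ℝ) * g (w (t + 1)).1| ≤ M.alive (w t).1 := by
    by_cases hw : (w t).1 = s
    · simpa [visit, alive, hw, hs] using hg _
    · simp [visit, hw, M.alive_nonneg]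
  have hle1 (t : ℕ) (w : StatePath S) : |(visit s t w : ℝ) * g (w (t + 1)).1| ≤ 1 :=
    (hle t w).trans ((le_abs_self _).trans (M.abs_alive_le _))
  have hi (t : ℕ) : Integrable (fun w : StatePath S => (visit s t w : ℝ) * g (w (t + 1)).1)
      M.law := integrable_of_abs_le (hm t) (ae_of_all _ (hle1 t))
  refine ⟨?_, ?_⟩
  · refine (M.integrable_len_pow hEff M.μ 1).mono'
      (M.measurable_sum_len hm).aestronglyMeasurable (ae_of_all _ fun w => ?_)
    refine (Finset.abs_sum_le_sum_abs _ _).trans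
      ((Finset.sum_le_sum fun t _ => hle1 t w).trans ?_)
    simp
  have key := integral_tsum_of_summable_integral_norm (μ := M.law)
    (F := fun t (w : StatePath S) => (visit s t w : ℝ) * g (w (t + 1)).1) hi
    (Summable.of_nonneg_of_le (fun t => integral_nonneg fun w => norm_nonneg _)
      (fun t => integral_mono (hi t).norm (integrable_of_abs_le
        (measurable_comp_state M.alive t) (ae_of_all _ fun w => M.abs_alive_le _)) (hle t))
      (M.summable_alive hEff hR M.μ))
  have h1 : ∫ w, ∑ t ∈ Finset.range (M.len w), (visit s t w : ℝ) * g (w (t + 1)).1 ∂M.law =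
      ∫ w, ∑' t, (visit s t w : ℝ) * g (w (t + 1)).1 ∂M.law := by
    refine integral_congr_ae ?_
    filter_upwards [M.ae_isRegular hEff hR M.μ] with w hw
    rw [tsum_eq_sum (s := Finset.range (M.len w))]
    intro t ht
    have : (w t).1 = M.term := (hw.term_iff t).2 (by simpa using ht)
    simp [visit, this, hs.symm]
  have h2 (t : ℕ) : ∫ w, (visit s t w : ℝ) * g (w (t + 1)).1 ∂M.law =
      (M.law {w | (w t).1 = s}).toReal * ∫ x, g x ∂M.P s := by
    have hgm : Measurable g := Measurable.of_discrete
    have hvm : Measurable fun v : StatePath S => (visit s t v : ℝ) :=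
      measurable_natCast_comp (measurable_visit s t)
    have hp := M.integral_past M.μ t (F := fun q => (visit s t q.1 : ℝ) * g q.2.2)
      ((hvm.comp measurable_fst).mul (hgm.comp (by fun_prop)))
      (by simp only [visit_past]; exact hi t)
    simp only [visit_past, integral_const_mul, integral_state_prod] at hp
    refine hp.trans ?_
    have h3 : (fun w : StatePath S => (visit s t w : ℝ) * ∫ x, g x ∂M.P (w t).1) =
        {w : StatePath S | (w t).1 = s}.indicator fun _ => ∫ x, g x ∂M.P s := by
      funext w
      by_cases hw : (w t).1 = s <;> simp [visit, hw]
    have hms : MeasurableSet {w : StatePath S | (w t).1 = s} := measurableSet_state {s} t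
    rw [h3, integral_indicator_const _ hms]
    rfl
  rw [h1, ← key, occ, ENNReal.tsum_toReal_eq fun t => measure_ne_top _ _, ← tsum_mul_right]
  exact tsum_congr h2

/-- A visit to a nonterminal state requires survival, so the occupancy is bounded by the summable
survival probabilities. -/
theorem occ_ne_top (hEff : M.EffectiveHorizon h) (hR : M.BoundedRewards) {s : S}
    (hs : s ≠ M.term) : M.occ s ≠ ∞ := by
  classical
  have hle (t : ℕ) : M.law {w | (w t).1 = s} ≤
      ENNReal.ofReal (∫ w, M.alive (w t).1 ∂M.law) := by
    have hms : MeasurableSet {w : StatePath S | (w t).1 = s} := measurableSet_state {s} t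
    rw [ENNReal.le_ofReal_iff_toReal_le (measure_ne_top _ _)
      (integral_nonneg fun w => M.alive_nonneg _)]
    have : (M.law {w : StatePath S | (w t).1 = s}).toReal =
        ∫ w, {w : StatePath S | (w t).1 = s}.indicator (fun _ => (1 : ℝ)) w ∂M.law := by
      rw [integral_indicator_const _ hms]
      simp [Measure.real]
    rw [this]
    refine integral_mono ((integrable_const _).indicator hms)
      (integrable_of_abs_le (measurable_comp_state M.alive t)
        (ae_of_all _ fun w => M.abs_alive_le _)) fun w => ?_
    by_cases hw : (w t).1 = s
    · simp [alive, hw, hs]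
    · simp [hw, M.alive_nonneg]
  exact ne_top_of_le_ne_top (M.summable_alive hEff hR M.μ).tsum_ofReal_ne_top
    (ENNReal.tsum_le_tsum hle)

/-- If `v = P_G v`, then `|v|` extended by zero off `G` is a function `f` with `f ≤ P f`. Iterating,
`f(s) ≤ E_s f(S_t)`, and this is at most a constant times `P_s(S_t ≠ ∅)`, which tends to zero. -/
theorem isUnit_one_sub_transG (hEff : M.EffectiveHorizon h) (hR : M.BoundedRewards) {G : Finset S}
    [DecidableEq G] (hG : M.term ∉ G) : IsUnit (1 - M.transG G) := by
  classical
  rw [← Matrix.mulVec_injective_iff_isUnit]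
  rw [← Matrix.coe_mulVecLin, ← LinearMap.ker_eq_bot, LinearMap.ker_eq_bot']
  intro v hv
  have hv (s : G) : v s = ∑ s' : G, (M.P s).real {s'.1} * v s' := by
    have := congrFun hv s
    simp only [Matrix.mulVecLin_apply, Matrix.sub_mulVec, Matrix.one_mulVec, Pi.sub_apply,
      Pi.zero_apply, sub_eq_zero] at this
    exact this
  let f : S → ℝ := fun s => ∑ s' : G, ({s'.1} : Set S).indicator (fun _ => |v s'|) s
  let K : ℝ := ∑ s' : G, |v s'|
  have hf0 (s : S) : 0 ≤ f s :=
    Finset.sum_nonneg fun s' _ => Set.indicator_nonneg (fun _ _ => abs_nonneg _) _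
  have hfG (s : G) : f s = |v s| := by
    simp only [f]
    rw [Finset.sum_eq_single s]
    · simp
    · intro b _ hb
      simp [hb.symm]
    · simp
  have hfK (s : S) : f s ≤ K * M.alive s := by
    unfold alive
    split_ifs with hs
    · rw [mul_zero]
      refine (Finset.sum_eq_zero fun s' _ => ?_).le
      have : s ≠ s' := by rintro rfl; exact hG (hs ▸ s'.2)
      simp [this]
    · rw [mul_one]
      refine Finset.sum_le_sum fun s' _ => Set.indicator_le_self' (fun _ _ => abs_nonneg _) _
  have hK : 0 ≤ K := Finset.sum_nonneg fun _ _ => abs_nonneg _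
  have hfabs (s : S) : |f s| ≤ K := by
    rw [abs_of_nonneg (hf0 s)]
    exact (hfK s).trans (mul_le_of_le_one_right hK ((le_abs_self _).trans (M.abs_alive_le s)))
  have hPf (s : S) : ∫ x, f x ∂M.P s = ∑ s' : G, (M.P s).real {s'.1} * |v s'| := by
    simp only [f]
    rw [integral_finsetSum _ fun s' _ => (integrable_const _).indicator (measurableSet_singleton _)]
    refine Finset.sum_congr rfl fun s' _ => ?_
    rw [integral_indicator_const _ (measurableSet_singleton _), smul_eq_mul]
  have hsub (s : S) : f s ≤ ∫ x, f x ∂M.P s := by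
    by_cases hs : s ∈ G
    · rw [hPf, show f s = |v ⟨s, hs⟩| from hfG ⟨s, hs⟩, hv ⟨s, hs⟩]
      refine (Finset.abs_sum_le_sum_abs _ _).trans_eq (Finset.sum_congr rfl fun s' _ => ?_)
      rw [abs_mul, abs_of_nonneg measureReal_nonneg]
    · have : f s = 0 := Finset.sum_eq_zero fun s' _ => by
        have : s ≠ s' := by rintro rfl; exact hs s'.2
        simp [this]
      rw [this]
      exact integral_nonneg hf0
  have hPfabs (s : S) : |∫ x, f x ∂M.P s| ≤ K := abs_integral_le_of_abs_le (ae_of_all _ hfabs)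
  ext s
  have hi (t : ℕ) : Integrable (fun w : StatePath S => f (w t).1) (M.lawFrom s) :=
    integrable_of_abs_le (measurable_comp_state f t) (ae_of_all _ fun w => hfabs _)
  have hge (t : ℕ) : f s ≤ ∫ w, f (w t).1 ∂M.lawFrom s := by
    induction t with
    | zero =>
      rw [integral_congr_ae (g := fun _ => f s)]
      · simp
      · filter_upwards [M.ae_initial s] with w hw
        rw [hw]
    | succ t ih =>
      rw [lawFrom, integral_state_succ M hfabs]
      refine ih.trans (integral_mono (hi t) ?_ fun w => hsub _)
      exact integrable_of_abs_le (measurable_comp_state (fun s => ∫ x, f x ∂M.P s) t)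
        (ae_of_all _ fun w => hPfabs _)
  have hlim : Tendsto (fun t => K * ∫ w, M.alive (w t).1 ∂M.lawFrom s) atTop (𝓝 0) := by
    rw [← mul_zero K]
    exact (M.summable_alive hEff hR (Measure.dirac s.1)).tendsto_atTop_zero.const_mul K
  have hle (t : ℕ) : f s ≤ K * ∫ w, M.alive (w t).1 ∂M.lawFrom s := by
    rw [← integral_const_mul]
    exact (hge t).trans (integral_mono (hi t) ((integrable_of_abs_le
      (measurable_comp_state M.alive t) (ae_of_all _ fun w => M.abs_alive_le _)).const_mul K)
      fun w => hfK _)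
  have h0 : |v s| ≤ 0 := by
    rw [← hfG]
    exact ge_of_tendsto' hlim hle
  exact abs_nonpos_iff.1 h0

end Covariance

end MRP

/-! ### Multivariate central limit theorem and linear images of Gaussian vectors. -/

section CentralLimit

variable {ι Ω : Type*} [Fintype ι] [DecidableEq ι] [MeasurableSpace Ω] {P : Measure Ω}
  [IsProbabilityMeasure P]

/-- Multivariate central limit theorem for centered vectors, given coordinatewise. -/
theorem tendstoInDistribution_multivariateGaussian {X : ℕ → Ω → EuclideanSpace ℝ ι}
    {A : Matrix ι ι ℝ} (hA : A.PosSemidef) (hX : ∀ i, AEMeasurable (X i) P)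
    (hind : iIndepFun X P) (hid : ∀ i, IdentDistrib (X i) (X 0) P P)
    (hL : ∀ u : EuclideanSpace ℝ ι, MemLp (fun ω => inner ℝ (X 0 ω) u) 2 P)
    (h0 : ∀ u : EuclideanSpace ℝ ι, ∫ ω, inner ℝ (X 0 ω) u ∂P = 0)
    (h2 : ∀ u : EuclideanSpace ℝ ι, ∫ ω, (inner ℝ (X 0 ω) u) ^ 2 ∂P = u ⬝ᵥ A *ᵥ u) :
    TendstoInDistribution (fun (n : ℕ) ω => (√n)⁻¹ • ∑ k ∈ Finset.range n, X k ω) atTop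
      (id : EuclideanSpace ℝ ι → EuclideanSpace ℝ ι) (fun _ => P) (multivariateGaussian 0 A) := by
  have hm (n : ℕ) : AEMeasurable (fun ω => (√n)⁻¹ • ∑ k ∈ Finset.range n, X k ω) P :=
    (Finset.aemeasurable_fun_sum (Finset.range n) fun k _ => hX k).const_smul (√n)⁻¹
  refine ⟨hm, aemeasurable_id, ?_⟩
  refine ProbabilityMeasure.tendsto_iff_tendsto_charFun.2 fun u => ?_
  have hmu : Measurable fun x : EuclideanSpace ℝ ι => inner ℝ x u := by fun_prop
  -- Cramér–Wold device: the characteristic function at `u` is that of the projection onto `u`,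
  -- evaluated at `1`, so the one-dimensional theorem suffices.
  have hcf {ν : Measure (EuclideanSpace ℝ ι)} : charFun ν u = charFun (ν.map fun x => inner ℝ x u) 1 := by
    rw [charFun_apply, charFun_apply, integral_map hmu.aemeasurable (by fun_prop)]
    simp
  have hvar : Var[fun ω => inner ℝ (X 0 ω) u; P] = u ⬝ᵥ A *ᵥ u := by
    rw [variance_of_integral_eq_zero (hL u).1.aemeasurable (h0 u), ← h2]
  have clt := tendstoInDistribution_inv_sqrt_mul_sum_sub (P := P)
    (X := fun k ω => inner ℝ (X k ω) u) (Y := id)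
    (P' := gaussianReal 0 Var[fun ω => inner ℝ (X 0 ω) u; P].toNNReal) HasLaw.id (hL u)
    (hind.comp (fun _ x => inner ℝ x u) fun _ => hmu) fun i => (hid i).comp hmu
  have := ProbabilityMeasure.tendsto_iff_tendsto_charFun.1 clt.tendsto 1
  simp only [ProbabilityMeasure.coe_mk, Measure.map_id] at this ⊢
  rw [charFun_multivariateGaussian hA]
  rw [charFun_gaussianReal, hvar] at this
  refine (this.congr fun n => ?_).trans_eq ?_
  · rw [hcf, AEMeasurable.map_map_of_aemeasurable hmu.aemeasurable (hm n)]
    congr 2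
    funext ω
    simp [h0, inner_smul_left, sum_inner]
  · congr 2
    have : 0 ≤ u ⬝ᵥ A *ᵥ u := by simpa using hA.dotProduct_mulVec_nonneg u
    simp [Real.coe_toNNReal _ this]

theorem multivariateGaussian_map_mulVec {A : Matrix ι ι ℝ} (hA : A.PosSemidef)
    (B : Matrix ι ι ℝ) :
    (multivariateGaussian 0 A).map (fun x => WithLp.toLp 2 (B *ᵥ x.ofLp)) =
      multivariateGaussian 0 (B * A * Bᵀ) := by
  have hBA : (B * A * Bᵀ).PosSemidef := by simpa using hA.mul_mul_conjTranspose_same B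
  have hm : Measurable fun x : EuclideanSpace ℝ ι => WithLp.toLp 2 (B *ᵥ x.ofLp) := by
    have : Continuous fun x : EuclideanSpace ℝ ι => WithLp.toLp 2 (B *ᵥ x.ofLp) := by fun_prop
    exact this.measurable
  have : IsProbabilityMeasure ((multivariateGaussian 0 A).map
    fun x : EuclideanSpace ℝ ι => WithLp.toLp 2 (B *ᵥ x.ofLp)) :=
    Measure.isProbabilityMeasure_map hm.aemeasurable
  refine Measure.ext_of_charFun ?_
  funext u
  have h1 : charFun ((multivariateGaussian 0 A).map
      fun x : EuclideanSpace ℝ ι => WithLp.toLp 2 (B *ᵥ x.ofLp)) u =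
      charFun (multivariateGaussian 0 A) (WithLp.toLp 2 (Bᵀ *ᵥ u.ofLp)) := by
    rw [charFun_apply, charFun_apply, integral_map hm.aemeasurable (by fun_prop)]
    congr 1
    funext x
    congr 3
    simp only [EuclideanSpace.inner_eq_star_dotProduct, star_trivial]
    rw [Matrix.dotProduct_mulVec, Matrix.mulVec_transpose]
  rw [h1, charFun_multivariateGaussian hA, charFun_multivariateGaussian hBA]
  simp only [← Matrix.mulVec_mulVec, inner_zero_right]
  congr 4
  rw [Matrix.dotProduct_mulVec u.ofLp B, ← Matrix.mulVec_transpose]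

end CentralLimit

namespace MRP

/-! ### Solvability of the empirical equation and the algebra of its residual. -/

section Estimator

variable {S : Type*} [MeasurableSpace S] {M : MRP S}

/-- `∑_{t < T} 1{S_t = s} f(S_t, R_t, S_{t+1}, R_{t+1}, …)`. -/
def visitSum (M : MRP S) (s : S) (f : StatePath S → ℝ) (w : StatePath S) : ℝ :=
  ∑ t ∈ Finset.range (M.len w), (visit s t w : ℝ) * f fun k => w (t + k)

/-- The index set `visits` includes the final time `t = len`, whereas `visitSum` stops before it.
The two agree because the state at that time is terminal and hence different from `s`. -/
theorem sum_visits {D : ℕ → StatePath S} (hD : ∀ i, M.IsRegular (D i)) {s : S} (hs : s ≠ M.term)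
    (n : ℕ) (f : StatePath S → ℝ) :
    ∑ q ∈ M.visits n D s, f (fun k => D q.1 (q.2 + k)) =
      ∑ i ∈ Finset.range n, M.visitSum s f (D i) := by
  classical
  rw [visits, Finset.sum_filter, Finset.sum_sigma]
  refine Finset.sum_congr rfl fun i _ => ?_
  rw [Finset.sum_range_succ, if_neg, add_zero]
  · refine Finset.sum_congr rfl fun t _ => ?_
    by_cases h : (D i t).1 = s <;> simp [visit, h]
  · simp only [((hD i).term_iff _).2 le_rfl]
    exact hs.symm

theorem card_visits {D : ℕ → StatePath S} (hD : ∀ i, M.IsRegular (D i)) {s : S} (hs : s ≠ M.term)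
    (n : ℕ) : ((M.visits n D s).card : ℝ) = ∑ i ∈ Finset.range n, M.visitSum s 1 (D i) := by
  rw [← sum_visits hD hs]
  simp

theorem empCond_eq {D : ℕ → StatePath S} (hD : ∀ i, M.IsRegular (D i)) {s : S} (hs : s ≠ M.term)
    (n : ℕ) (f : StatePath S → ℝ) : M.empCond n D s f =
      (∑ i ∈ Finset.range n, M.visitSum s f (D i)) / ∑ i ∈ Finset.range n, M.visitSum s 1 (D i) := by
  rw [empCond, sum_visits hD hs, card_visits hD hs]

/-- A maximum principle on the data. Let `v = P̂ v` be nonzero and take a state where `|v|` is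
maximal. Every visit to such a state must be followed by another such state, still in `G`, so an
observed trajectory never terminates. -/
theorem isUnit_one_sub_transHat {D : ℕ → StatePath S} (hD : ∀ i, M.IsRegular (D i)) {G : Finset S}
    [DecidableEq G] (hG : M.term ∉ G) (n : ℕ) : IsUnit (1 - M.transHat G n D) := by
  classical
  rw [← Matrix.mulVec_injective_iff_isUnit]
  rw [← Matrix.coe_mulVecLin, ← LinearMap.ker_eq_bot, LinearMap.ker_eq_bot']
  intro v hv
  let g (q : Σ _ : ℕ, ℕ) : ℝ := ∑ s' : G, if (D q.1 (q.2 + 1)).1 = s' then v s' else 0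
  have hv (s : G) : v s = (∑ q ∈ M.visits n D s, g q) / (M.visits n D s).card := by
    have h1 := congrFun hv s
    simp only [Matrix.mulVecLin_apply, Matrix.sub_mulVec, Matrix.one_mulVec, Pi.sub_apply,
      Pi.zero_apply, sub_eq_zero] at h1
    rw [h1, Finset.sum_comm, Finset.sum_div]
    refine Finset.sum_congr rfl fun s' _ => ?_
    simp only [transHat, Matrix.of_apply, empCond]
    rw [div_mul_eq_mul_div, Finset.sum_mul]
    simp
  by_contra hne
  obtain ⟨s₁, hs₁⟩ := Function.ne_iff.1 hne
  obtain ⟨s, -, hs⟩ := Finset.exists_max_image Finset.univ (fun s => |v s|) ⟨s₁, Finset.mem_univ _⟩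
  have hmpos : 0 < |v s| := (abs_pos.2 hs₁).trans_le (hs s₁ (Finset.mem_univ _))
  have hgcases (q : Σ _ : ℕ, ℕ) : g q = 0 ∨ ∃ s' : G, (D q.1 (q.2 + 1)).1 = s' ∧ g q = v s' := by
    by_cases hq : (D q.1 (q.2 + 1)).1 ∈ G
    · refine Or.inr ⟨⟨_, hq⟩, rfl, ?_⟩
      simp only [g]
      rw [Finset.sum_eq_single ⟨_, hq⟩]
      · simp
      · intro b _ hb
        rw [if_neg]
        exact fun h => hb (Subtype.ext h.symm)
      · simp
    · left
      exact Finset.sum_eq_zero fun s' _ =>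
        if_neg fun h : (D q.1 (q.2 + 1)).1 = s' => hq (h ▸ s'.2)
  have hgle (q : Σ _ : ℕ, ℕ) : |g q| ≤ |v s| := by
    rcases hgcases q with h | ⟨s', -, h⟩
    · rw [h, abs_zero]; exact hmpos.le
    · rw [h]; exact hs s' (Finset.mem_univ _)
  -- An unvisited state has an empirical row of zeros, by `0 / 0 = 0`, hence `v a = 0`; a maximal
  -- value is therefore attained only at visited states.
  have hnon (a : G) (ha : |v a| = |v s|) : (M.visits n D a).Nonempty := by
    by_contra h
    rw [Finset.not_nonempty_iff_eq_empty] at h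
    have := hv a
    rw [h] at this
    simp only [Finset.sum_empty, zero_div] at this
    rw [this, abs_zero] at ha
    exact hmpos.ne ha
  have hstep (a : G) (ha : |v a| = |v s|) (q) (hq : q ∈ M.visits n D a) :
      ∃ b : G, (D q.1 (q.2 + 1)).1 = b ∧ |v b| = |v s| := by
    have hcard : (0 : ℝ) < (M.visits n D a).card := by exact_mod_cast Finset.card_pos.2 ⟨q, hq⟩
    -- An average of terms bounded by `|v s|` reaches this modulus only if every term does.
    have hgq : |g q| = |v s| := by
      refine le_antisymm (hgle q) (not_lt.1 fun hlt => ?_)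
      have h1 : |∑ q ∈ M.visits n D a, g q| < (M.visits n D a).card * |v s| := by
        refine (Finset.abs_sum_le_sum_abs _ _).trans_lt ?_
        rw [← nsmul_eq_mul, ← Finset.sum_const]
        exact Finset.sum_lt_sum (fun q _ => hgle q) ⟨q, hq, hlt⟩
      have h2 := congrArg abs (hv a)
      rw [abs_div, Nat.abs_cast, ha, eq_div_iff hcard.ne'] at h2
      linarith
    rcases hgcases q with h | ⟨b, hb, h⟩
    · rw [h, abs_zero] at hgq
      exact absurd hgq hmpos.ne
    · exact ⟨b, hb, h ▸ hgq⟩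
  obtain ⟨q, hq⟩ := hnon s rfl
  have hmem (a : S) (q : Σ _ : ℕ, ℕ) : q ∈ M.visits n D a ↔
      (q.1 < n ∧ q.2 ≤ M.len (D q.1)) ∧ (D q.1 q.2).1 = a := by
    simp [visits]
  have hq' := (hmem _ _).1 hq
  have hstay (k : ℕ) : q.2 + k ≤ M.len (D q.1) ∧
      ∃ a : G, (D q.1 (q.2 + k)).1 = a ∧ |v a| = |v s| := by
    induction k with
    | zero => exact ⟨hq'.1.2, s, hq'.2, rfl⟩
    | succ k ih =>
      obtain ⟨hlen, a, ha, hva⟩ := ih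
      obtain ⟨b, hb, hvb⟩ := hstep a hva ⟨q.1, q.2 + k⟩ ((hmem _ _).2 ⟨⟨hq'.1.1, hlen⟩, ha⟩)
      refine ⟨?_, b, hb, hvb⟩
      have hne : ¬ M.len (D q.1) ≤ q.2 + k := by
        rw [← (hD q.1).term_iff, ha]
        rintro hterm
        exact hG (hterm ▸ a.2)
      omega
  have := (hstay (M.len (D q.1) + 1)).1
  omega

theorem len_shift {w : StatePath S} (hw : M.IsRegular w) {t : ℕ} (ht : t ≤ M.len w) :
    M.len (fun k => w (t + k)) = M.len w - t := by
  have hlast : (w (t + (M.len w - t))).1 = M.term := (hw.term_iff _).2 (by omega)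
  refine le_antisymm (Nat.sInf_le hlast) ?_
  have hmem : M.len (fun k => w (t + k)) ∈ {k | (w (t + k)).1 = M.term} := Nat.sInf_mem ⟨_, hlast⟩
  have := (hw.term_iff _).1 hmem
  omega

variable [Countable S] [MeasurableSingletonClass S]

theorem sum_increment {w : StatePath S} (hw : M.IsRegular w) {t : ℕ} (ht : t ≤ M.len w) :
    ∑ l ∈ Finset.Ico t (M.len w), M.increment l w =
      ∑ l ∈ Finset.Ico t (M.len w), (w l).2 - M.V (w t).1 := by
  have h1 := Finset.sum_Ico_sub (fun l => M.V (w l).1) ht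
  rw [(hw.term_iff _).2 le_rfl, V_term] at h1
  simp only [increment, add_sub_assoc, Finset.sum_add_distrib, h1]
  ring

/-- Total error of the empirical Bellman equation at `s`, as a martingale transform. -/
theorem visitSum_residual {w : StatePath S} (hw : M.IsRegular w) (G : Finset S) (s : S) :
    (M.visitSum s (fun w => (w 0).2) w +
      ∑ s' : G, M.visitSum s (fun w => ({s'.1} : Set S).indicator 1 (w 1).1) w * M.V s') +
      M.visitSum s (fun w => ({x | x ∉ G} : Set S).indicator
        (fun _ => ∑ l ∈ Finset.Ico 1 (M.len w), (w l).2) (w 1).1) w - M.visitSum s 1 w * M.V s =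
      ∑ j ∈ Finset.range (M.len w), (weight G s j w : ℝ) * M.increment j w := by
  classical
  simp only [visitSum, Finset.sum_mul]
  rw [Finset.sum_comm, ← Finset.sum_add_distrib, ← Finset.sum_add_distrib,
    ← Finset.sum_sub_distrib]
  -- A transition into `G` leaves the single temporal difference at `t`. A direct exit puts the
  -- observed return in place of the value, and the return minus `V⋆(S_t)` telescopes into all the
  -- temporal differences from `t` on.
  have hterm : ∀ t ∈ Finset.range (M.len w),
      (visit s t w : ℝ) * (w (t + 0)).2 + ∑ s' : G, (visit s t w : ℝ) *
        ({s'.1} : Set S).indicator 1 (w (t + 1)).1 * M.V s' +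
        (visit s t w : ℝ) * ({x | x ∉ G} : Set S).indicator
          (fun _ => ∑ l ∈ Finset.Ico 1 (M.len fun k => w (t + k)), (w (t + l)).2) (w (t + 1)).1 -
        (visit s t w : ℝ) * (1 : StatePath S → ℝ) (fun k => w (t + k)) * M.V s =
      (visit s t w : ℝ) * M.increment t w +
        ∑ l ∈ Finset.Ico (t + 1) (M.len w), (exitAt G s t w : ℝ) * M.increment l w := by
    intro t ht
    have ht : t < M.len w := Finset.mem_range.1 ht
    by_cases hs : (w t).1 = s
    · have hG : ∑ s' : G, ({s'.1} : Set S).indicator (1 : S → ℝ) (w (t + 1)).1 * M.V s' =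
          if (w (t + 1)).1 ∈ G then M.V (w (t + 1)).1 else 0 := by
        rw [Finset.sum_coe_sort G fun s' => ({s'} : Set S).indicator (1 : S → ℝ) (w (t + 1)).1 *
          M.V s']
        simp only [Set.indicator_apply, Set.mem_singleton_iff, Pi.one_apply, ite_mul, one_mul,
          zero_mul]
        rw [Finset.sum_ite_eq]
      have hshift : ∑ l ∈ Finset.Ico 1 (M.len fun k => w (t + k)), (w (t + l)).2 =
          ∑ l ∈ Finset.Ico (t + 1) (M.len w), (w l).2 := by
        rw [len_shift hw ht.le, Finset.sum_Ico_add (fun l => (w l).2)]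
        congr 2 <;> omega
      rw [← Finset.mul_sum, sum_increment hw ht, hshift]
      have hv : visit s t w = 1 := by simp [visit, hs]
      simp only [hv, Nat.cast_one, one_mul, hG, increment, exitAt, hs]
      by_cases hx : (w (t + 1)).1 ∈ G
      · simp [hx]
      · simp [hx]; ring
    · simp [visit, exitAt, hs]
  -- Exchanging the order of summation over pairs `t < j` collects, in front of the difference at
  -- `j`, the number of exits before `j`.
  rw [Finset.sum_congr rfl hterm, Finset.sum_add_distrib, Finset.range_eq_Ico,
    Finset.sum_Ico_Ico_comm', ← Finset.sum_add_distrib]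
  refine Finset.sum_congr rfl fun j _ => ?_
  rw [← Finset.range_eq_Ico, weight, exits, ← Finset.sum_mul]
  push_cast
  ring

end Estimator

end MRP

namespace MRP

/-! ### Moments of the residual and exact formula for the estimation error. -/

section Asymptotics

variable {S : Type*} [MeasurableSpace S] [Countable S] [MeasurableSingletonClass S] {M : MRP S}
  {h : ℝ}

theorem measurable_visitSum (M : MRP S) (s : S) {f : StatePath S → ℝ} (hf : Measurable f) :
    Measurable (M.visitSum s f) :=
  M.measurable_sum_len fun t => (measurable_natCast_comp (measurable_visit s t)).mul
    (hf.comp (measurable_pi_lambda _ fun k => measurable_pi_apply (t + k)))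

/-- Contribution of one trajectory to the error of the Bellman equation at `s`. -/
def tdError (M : MRP S) (G : Finset S) (s : S) (w : StatePath S) : ℝ :=
  ∑ j ∈ Finset.range (M.len w), (weight G s j w : ℝ) * M.increment j w

theorem measurable_tdError (M : MRP S) (G : Finset S) (s : S) : Measurable (M.tdError G s) :=
  M.measurable_sum_len fun j => (measurable_natCast_comp (measurable_weight G s j)).mul
    (M.measurable_increment_path j)

/-- Identifies the second moment delivered by `martingaleTransform` with a squared norm in
`L²(energy)`. -/
theorem integral_energy_sq (hEff : M.EffectiveHorizon h) (hR : M.BoundedRewards)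
    {H : ℕ → StatePath S → ℝ} (hm : ∀ j, Measurable (H j)) {c x : ℝ}
    (hb : ∀ j w, |H j w| ≤ c * (j + 1))
    (hx : HasSum (fun j => ∫ w, H j w ^ 2 * M.oneStepVar (w j).1 ∂M.law) x) :
    ∫ p, H p.1 p.2 ^ 2 ∂M.energy = x := by
  have hnn (j : ℕ) (w : StatePath S) : 0 ≤ H j w ^ 2 * M.oneStepVar (w j).1 :=
    mul_nonneg (sq_nonneg _) (M.oneStepVar_nonneg _)
  have hvm (j : ℕ) := measurable_comp_state M.oneStepVar j
  have hi (j : ℕ) : Integrable (fun w => H j w ^ 2 * M.oneStepVar (w j).1) M.law := by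
    refine integrable_of_abs_le (((hm j).pow_const 2).mul (hvm j))
      (c := (c * (j + 1)) ^ 2 * ((1 + 2 * |h|) ^ 2 * 1)) (ae_of_all _ fun w => ?_)
    rw [abs_of_nonneg (hnn j w), ← sq_abs]
    have h1 := M.oneStepVar_le hEff hR (w j).1
    have h2 := (le_abs_self _).trans (M.abs_alive_le (w j).1)
    have h3 := hb j w
    have h4 := M.oneStepVar_nonneg (w j).1
    calc _ ≤ (c * (j + 1)) ^ 2 * ((1 + 2 * |h|) ^ 2 * M.alive (w j).1) := by gcongr
      _ ≤ _ := by gcongr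
  rw [integral_eq_lintegral_of_nonneg_ae (ae_of_all _ fun p => sq_nonneg _)
    ((measurable_uncurry_time hm).pow_const 2).aestronglyMeasurable,
    lintegral_energy M (F := fun j w => ENNReal.ofReal (H j w ^ 2))
      fun j => ((hm j).pow_const 2).ennreal_ofReal]
  have hterm (j : ℕ) : ∫⁻ w, ENNReal.ofReal (H j w ^ 2) * ENNReal.ofReal (M.oneStepVar (w j).1)
      ∂M.law = ENNReal.ofReal (∫ w, H j w ^ 2 * M.oneStepVar (w j).1 ∂M.law) := by
    rw [ofReal_integral_eq_lintegral_ofReal (hi j) (ae_of_all _ (hnn j))]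
    exact lintegral_congr fun w => (ENNReal.ofReal_mul (sq_nonneg _)).symm
  simp_rw [hterm]
  have hpos (j : ℕ) : 0 ≤ ∫ w, H j w ^ 2 * M.oneStepVar (w j).1 ∂M.law :=
    integral_nonneg (hnn j)
  rw [← ENNReal.ofReal_tsum_of_nonneg hpos hx.summable, hx.tsum_eq,
    ENNReal.toReal_ofReal (hx.nonneg hpos)]

/-- `Λ⋆_G` as a Gram matrix. -/
def covMatrix (M : MRP S) (G : Finset S) : Matrix G G ℝ :=
  Matrix.of fun s s' => ∫ p, (weight G s.1 p.1 p.2 : ℝ) * weight G s'.1 p.1 p.2 ∂M.energy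

theorem posSemidef_covMatrix (hEff : M.EffectiveHorizon h) (hR : M.BoundedRewards)
    (G : Finset S) : (M.covMatrix G).PosSemidef :=
  posSemidef_integral_mul (f := fun (s : G) (p : ℕ × StatePath S) => (weight G s.1 p.1 p.2 : ℝ))
    fun s s' => integrable_weight_mul hEff hR G s s'

/-- A linear combination of the residuals is again a martingale transform, with the combined weight
`∑ u_s H_j(s)`. Thus the scalar second-moment formula yields the whole covariance matrix. -/
theorem moments_tdError (hEff : M.EffectiveHorizon h) (hR : M.BoundedRewards) (G : Finset S)
    (u : G → ℝ) :
    MemLp (fun w => ∑ s : G, u s * M.tdError G s w) 2 M.law ∧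
    ∫ w, ∑ s : G, u s * M.tdError G s w ∂M.law = 0 ∧
    ∫ w, (∑ s : G, u s * M.tdError G s w) ^ 2 ∂M.law = u ⬝ᵥ M.covMatrix G *ᵥ u := by
  let H (j : ℕ) (w : StatePath S) : ℝ := ∑ s : G, u s * (weight G s j w : ℝ)
  have hm (j : ℕ) : Measurable (H j) := Finset.measurable_fun_sum _ fun s _ =>
    (measurable_natCast_comp (measurable_weight G s j)).const_mul _
  have hb (j : ℕ) (w : StatePath S) : |H j w| ≤ (∑ s : G, |u s|) * (j + 1) := by
    rw [Finset.sum_mul]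
    refine (Finset.abs_sum_le_sum_abs _ _).trans (Finset.sum_le_sum fun s _ => ?_)
    rw [abs_mul]
    have := abs_weight_le G s j w
    rw [one_mul] at this
    gcongr
  have hmt := martingaleTransform (M := M) (H := H) M.μ hEff hR hm
    (fun j w => by simp only [H, weight_past]) hb
  have heq (w : StatePath S) : ∑ s : G, u s * M.tdError G s w =
      ∑ j ∈ Finset.range (M.len w), H j w * M.increment j w := by
    simp only [tdError, H, Finset.mul_sum, Finset.sum_mul]
    rw [Finset.sum_comm]
    exact Finset.sum_congr rfl fun j _ => Finset.sum_congr rfl fun s _ => by ring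
  simp_rw [heq]
  refine ⟨hmt.1, hmt.2.1, ?_⟩
  rw [covMatrix, dotProduct_integral_mulVec
    (f := fun (s : G) (p : ℕ × StatePath S) => (weight G s.1 p.1 p.2 : ℝ))
    fun s s' => integrable_weight_mul hEff hR G s s']
  exact (integral_energy_sq hEff hR hm hb hmt.2.2).symm

/-- The empirical transition matrix, as a measurable function of the data. -/
def transRatio (M : MRP S) (G : Finset S) (n : ℕ) (D : ℕ → StatePath S) : Matrix G G ℝ :=
  Matrix.of fun s s' =>
    (∑ i ∈ Finset.range n, M.visitSum s (fun w => ({s'.1} : Set S).indicator 1 (w 1).1) (D i)) /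
      ∑ i ∈ Finset.range n, M.visitSum s 1 (D i)

theorem transHat_eq {D : ℕ → StatePath S} (hD : ∀ i, M.IsRegular (D i)) {G : Finset S}
    (hG : M.term ∉ G) (n : ℕ) : M.transHat G n D = M.transRatio G n D := by
  classical
  ext s s'
  have hs : s.1 ≠ M.term := fun hs => hG (hs ▸ s.2)
  simp only [transHat, transRatio, Matrix.of_apply, empCond_eq hD hs]
  congr 2

theorem isSubgraphBellman_iff {D : ℕ → StatePath S} (hD : ∀ i, M.IsRegular (D i)) {G : Finset S}
    [DecidableEq G] (hG : M.term ∉ G) (n : ℕ) (v : G → ℝ) : M.IsSubgraphBellman G n D v ↔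
      v = (1 - M.transHat G n D)⁻¹ *ᵥ (M.rHat G n D + M.outHat G n D) := by
  have hu := isUnit_one_sub_transHat hD hG n
  have hdet := (Matrix.isUnit_iff_isUnit_det _).1 hu
  have h1 : M.IsSubgraphBellman G n D v ↔
      (1 - M.transHat G n D) *ᵥ v = M.rHat G n D + M.outHat G n D := by
    rw [IsSubgraphBellman, Matrix.sub_mulVec, Matrix.one_mulVec, sub_eq_iff_eq_add]
    rw [add_right_comm]
  rw [h1]
  constructor
  · rintro h2
    rw [← h2, Matrix.mulVec_mulVec, Matrix.nonsing_inv_mul _ hdet, Matrix.one_mulVec]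
  · rintro rfl
    rw [Matrix.mulVec_mulVec, Matrix.mul_nonsing_inv _ hdet, Matrix.one_mulVec]

/-- Subtracting the empirical equation for `v` from the residual of `V⋆` cancels rewards and exit
returns, leaving `(I - P̂)(V⋆ - v) = -residual / visits`. Nonzero visit counts are needed: at an
unvisited state the empirical equation forces `v s = 0`. -/
theorem V_sub_eq {D : ℕ → StatePath S} (hD : ∀ i, M.IsRegular (D i)) {G : Finset S}
    [DecidableEq G] (hG : M.term ∉ G) {n : ℕ} {v : G → ℝ} (hv : M.IsSubgraphBellman G n D v)
    (hN : ∀ s : G, ∑ i ∈ Finset.range n, M.visitSum s 1 (D i) ≠ 0) :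
    (fun s : G => M.V s - v s) = (1 - M.transRatio G n D)⁻¹ *ᵥ fun s : G =>
      -((∑ i ∈ Finset.range n, M.tdError G s (D i)) /
        ∑ i ∈ Finset.range n, M.visitSum s 1 (D i)) := by
  classical
  have hu := isUnit_one_sub_transHat hD hG n
  have hdet := (Matrix.isUnit_iff_isUnit_det _).1 hu
  rw [← transHat_eq hD hG]
  have key : (1 - M.transHat G n D) *ᵥ (fun s : G => M.V s - v s) = fun s : G =>
      -((∑ i ∈ Finset.range n, M.tdError G s (D i)) /
        ∑ i ∈ Finset.range n, M.visitSum s 1 (D i)) := by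
    ext s
    have hs : s.1 ≠ M.term := fun hs => hG (hs ▸ s.2)
    have hvs := congrFun hv s
    have hsub : (fun s : G => M.V s - v s) = (fun s : G => M.V s) - v := rfl
    have htd : ∑ i ∈ Finset.range n, M.tdError G s (D i) =
        ∑ i ∈ Finset.range n, M.visitSum s (fun w => (w 0).2) (D i) +
        ∑ s' : G, (∑ i ∈ Finset.range n,
          M.visitSum s (fun w => ({s'.1} : Set S).indicator 1 (w 1).1) (D i)) * M.V s' +
        ∑ i ∈ Finset.range n, M.visitSum s (fun w => ({x | x ∉ G} : Set S).indicator
          (fun _ => ∑ l ∈ Finset.Ico 1 (M.len w), (w l).2) (w 1).1) (D i) -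
        (∑ i ∈ Finset.range n, M.visitSum s 1 (D i)) * M.V s := by
      simp only [tdError, ← visitSum_residual (hD _) G, Finset.sum_sub_distrib,
        Finset.sum_add_distrib, Finset.sum_mul]
      rw [Finset.sum_comm]
    have hr : M.rHat G n D s = (∑ i ∈ Finset.range n, M.visitSum s (fun w => (w 0).2) (D i)) /
        ∑ i ∈ Finset.range n, M.visitSum s 1 (D i) := empCond_eq hD hs n _
    have ho : M.outHat G n D s = (∑ i ∈ Finset.range n, M.visitSum s
        (fun w => ({x | x ∉ G} : Set S).indicator
          (fun _ => ∑ l ∈ Finset.Ico 1 (M.len w), (w l).2) (w 1).1) (D i)) /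
        ∑ i ∈ Finset.range n, M.visitSum s 1 (D i) := by
      rw [outHat, empCond_eq hD hs]
      simp only [Set.indicator_apply, Set.mem_ofPred_eq]
    have hP : (M.transHat G n D *ᵥ fun s : G => M.V s) s = (∑ s' : G, (∑ i ∈ Finset.range n,
          M.visitSum s (fun w => ({s'.1} : Set S).indicator 1 (w 1).1) (D i)) * M.V s') /
        ∑ i ∈ Finset.range n, M.visitSum s 1 (D i) := by
      rw [transHat_eq hD hG, Finset.sum_div]
      refine Finset.sum_congr rfl fun s' _ => ?_
      simp only [transRatio, Matrix.of_apply]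
      ring
    rw [hsub, Matrix.sub_mulVec, Matrix.one_mulVec, Matrix.mulVec_sub]
    simp only [Pi.sub_apply, Pi.add_apply] at hvs ⊢
    rw [hP, htd]
    rw [hr, ho] at hvs
    have := hN s
    linear_combination (norm := skip) (-1 : ℝ) * hvs
    field_simp
    ring
  rw [← key, Matrix.mulVec_mulVec, Matrix.nonsing_inv_mul _ hdet, Matrix.one_mulVec]

end Asymptotics

end MRP

namespace MRP

/-! ### Laws of large numbers, measurability and the limit in distribution. -/

section Asymptotics

variable {S : Type*} [MeasurableSpace S] [Countable S] [MeasurableSingletonClass S] {M : MRP S}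
  {h : ℝ} {Ω : Type*} [MeasurableSpace Ω] {Pr : Measure Ω} [IsProbabilityMeasure Pr]
  {τ : ℕ → Ω → StatePath S}

/-- Cramer's rule: the adjugate and the determinant are continuous in the entries, and real
inversion is measurable also with the value `0` at `0`. -/
theorem measurable_inv_entry {ι : Type*} [Fintype ι] [DecidableEq ι] {α : Type*}
    [MeasurableSpace α] {A : α → Matrix ι ι ℝ} (hA : ∀ i j, Measurable fun x => A x i j)
    (i j : ι) : Measurable fun x => (A x)⁻¹ i j := by
  have h1 : Continuous fun a : ι → ι → ℝ => (Matrix.of a).det :=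
    Continuous.matrix_det (by exact continuous_id)
  have h2 : Continuous fun a : ι → ι → ℝ => (Matrix.of a).adjugate i j :=
    (Continuous.matrix_adjugate (by exact continuous_id)).matrix_elem i j
  have hm : Measurable fun x => (fun i j => A x i j : ι → ι → ℝ) :=
    measurable_pi_lambda _ fun i => measurable_pi_lambda _ fun j => hA i j
  have h3 := ((h1.measurable.comp hm).inv).mul (h2.measurable.comp hm)
  convert! h3 using 1
  funext x
  rw [Matrix.inv_def, Ring.inverse_eq_inv']
  rfl

theorem ae_data_isRegular (hEff : M.EffectiveHorizon h) (hR : M.BoundedRewards)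
    (hlaw : ∀ i, HasLaw (τ i) M.law Pr) : ∀ᵐ ω ∂Pr, ∀ i, M.IsRegular (τ i ω) := by
  refine ae_all_iff.2 fun i => ae_of_ae_map (hlaw i).aemeasurable ?_
  rw [(hlaw i).map_eq]
  exact M.ae_isRegular hEff hR M.μ

theorem ae_tendsto_mean (hlaw : ∀ i, HasLaw (τ i) M.law Pr) (hind : iIndepFun τ Pr)
    {F : StatePath S → ℝ} (hF : Measurable F) (hi : Integrable F M.law) :
    ∀ᵐ ω ∂Pr, Tendsto (fun n : ℕ => (∑ i ∈ Finset.range n, F (τ i ω)) / n) atTop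
      (𝓝 (∫ w, F w ∂M.law)) := by
  have h0 : ∫ ω, F (τ 0 ω) ∂Pr = ∫ w, F w ∂M.law := by
    rw [← (hlaw 0).map_eq, integral_map (hlaw 0).aemeasurable hF.aestronglyMeasurable]
  rw [← h0]
  refine strong_law_ae_real (fun i ω => F (τ i ω)) ?_ ?_ ?_
  · rw [← (hlaw 0).map_eq] at hi
    exact hi.comp_aemeasurable (hlaw 0).aemeasurable
  · exact fun i j hij => (hind.comp (fun _ => F) fun _ => hF).indepFun hij
  · exact fun i => ((hlaw i).identDistrib (hlaw 0)).comp hF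

theorem ae_tendsto_visitSum_one (hEff : M.EffectiveHorizon h) (hR : M.BoundedRewards)
    (hlaw : ∀ i, HasLaw (τ i) M.law Pr) (hind : iIndepFun τ Pr) {s : S} (hs : s ≠ M.term) :
    ∀ᵐ ω ∂Pr, Tendsto (fun n : ℕ => (∑ i ∈ Finset.range n, M.visitSum s 1 (τ i ω)) / n) atTop
      (𝓝 (M.occ s).toReal) := by
  have h1 := integral_sum_visit hEff hR hs (g := fun _ => 1) (by simp)
  have h2 := ae_tendsto_mean hlaw hind (M.measurable_visitSum s measurable_one) h1.1
  have h3 : ∫ w, M.visitSum s 1 w ∂M.law = (M.occ s).toReal := h1.2.trans (by simp)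
  rwa [h3] at h2

theorem ae_tendsto_visitSum_indicator (hEff : M.EffectiveHorizon h) (hR : M.BoundedRewards)
    (hlaw : ∀ i, HasLaw (τ i) M.law Pr) (hind : iIndepFun τ Pr) {s : S} (hs : s ≠ M.term)
    (s' : S) :
    ∀ᵐ ω ∂Pr, Tendsto (fun n : ℕ => (∑ i ∈ Finset.range n,
      M.visitSum s (fun w => ({s'} : Set S).indicator 1 (w 1).1) (τ i ω)) / n) atTop
      (𝓝 ((M.occ s).toReal * (M.P s).real {s'})) := by
  have h1 := integral_sum_visit hEff hR hs (g := ({s'} : Set S).indicator 1) fun x => by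
    by_cases hx : x = s' <;> simp [hx]
  have h2 := ae_tendsto_mean hlaw hind (M.measurable_visitSum s
    (measurable_comp_state (({s'} : Set S).indicator (1 : S → ℝ)) 1)) h1.1
  have h3 := h1.2
  rw [integral_indicator_one (measurableSet_singleton s')] at h3
  exact h3 ▸ h2

/-- The random matrix that maps the normalized sum of errors to the error of the estimator. -/
def errorMatrix (M : MRP S) (G : Finset S) [DecidableEq G] (n : ℕ) (D : ℕ → StatePath S) :
    G → G → ℝ :=
  fun s s' => -((1 - M.transRatio G n D)⁻¹ s s' *
    ((∑ i ∈ Finset.range n, M.visitSum s' 1 (D i)) / n)⁻¹)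

/-- The limit of `errorMatrix`. -/
def limitMatrix (M : MRP S) (G : Finset S) [DecidableEq G] : G → G → ℝ :=
  fun s s' => -((1 - M.transG G)⁻¹ s s' * (M.occ s').toReal⁻¹)

theorem measurable_sum_comp {f : StatePath S → ℝ} (hf : Measurable f) (n : ℕ) :
    Measurable fun D : ℕ → StatePath S => ∑ i ∈ Finset.range n, f (D i) :=
  Finset.measurable_fun_sum _ fun i _ => hf.comp (measurable_pi_apply i)

theorem measurable_transRatio (M : MRP S) (G : Finset S) (n : ℕ) (s s' : G) :
    Measurable fun D : ℕ → StatePath S => M.transRatio G n D s s' := by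
  have h1 := measurable_sum_comp (M.measurable_visitSum s.1
    (measurable_comp_state (({s'.1} : Set S).indicator (1 : S → ℝ)) 1)) n
  have h2 := measurable_sum_comp (M.measurable_visitSum s.1 measurable_one) n
  exact h1.div h2

theorem measurable_one_sub_transRatio_inv (M : MRP S) (G : Finset S) [DecidableEq G] (n : ℕ)
    (s s' : G) :
    Measurable fun D : ℕ → StatePath S => (1 - M.transRatio G n D)⁻¹ s s' :=
  measurable_inv_entry (A := fun D => 1 - M.transRatio G n D)
    (fun i j => (M.measurable_transRatio G n i j).const_sub _) s s'

theorem measurable_errorMatrix (M : MRP S) (G : Finset S) [DecidableEq G] (n : ℕ) :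
    Measurable (M.errorMatrix G n) := by
  refine measurable_pi_lambda _ fun s => measurable_pi_lambda _ fun s' => ?_
  have h2 := measurable_sum_comp (M.measurable_visitSum s'.1 measurable_one) n
  exact ((M.measurable_one_sub_transRatio_inv G n s s').mul (h2.div_const _).inv).neg

theorem ae_tendsto_errorMatrix (hEff : M.EffectiveHorizon h) (hR : M.BoundedRewards)
    {G : Finset S} [DecidableEq G] (hG : M.term ∉ G) (hν : ∀ s ∈ G, (M.occ s).toReal ≠ 0)
    (hlaw : ∀ i, HasLaw (τ i) M.law Pr) (hind : iIndepFun τ Pr) :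
    ∀ᵐ ω ∂Pr, Tendsto (fun n => M.errorMatrix G n fun i => τ i ω) atTop
      (𝓝 (M.limitMatrix G)) := by
  have hne (s : G) : s.1 ≠ M.term := fun hs => hG (hs ▸ s.2)
  have h1 : ∀ᵐ ω ∂Pr, ∀ s : G, Tendsto (fun n : ℕ => (∑ i ∈ Finset.range n,
      M.visitSum s 1 (τ i ω)) / n) atTop (𝓝 (M.occ s).toReal) :=
    ae_all_iff.2 fun s => ae_tendsto_visitSum_one hEff hR hlaw hind (hne s)
  have h2 : ∀ᵐ ω ∂Pr, ∀ s s' : G, Tendsto (fun n : ℕ => (∑ i ∈ Finset.range n,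
      M.visitSum s (fun w => ({s'.1} : Set S).indicator 1 (w 1).1) (τ i ω)) / n) atTop
      (𝓝 ((M.occ s).toReal * (M.P s).real {s'.1})) :=
    ae_all_iff.2 fun s => ae_all_iff.2 fun s' =>
      ae_tendsto_visitSum_indicator hEff hR hlaw hind (hne s) s'.1
  have hdet : (1 - M.transG G).det ≠ 0 :=
    ((Matrix.isUnit_iff_isUnit_det _).1 (isUnit_one_sub_transG hEff hR hG)).ne_zero
  filter_upwards [h1, h2] with ω h1 h2
  have hP : Tendsto (fun n => M.transRatio G n fun i => τ i ω) atTop (𝓝 (M.transG G)) := by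
    refine tendsto_pi_nhds.2 fun s => tendsto_pi_nhds.2 fun s' => ?_
    have hlim := (h2 s s').div (h1 s) (hν s s.2)
    rw [mul_div_cancel_left₀ _ (hν s s.2)] at hlim
    refine hlim.congr' ?_
    filter_upwards [eventually_gt_atTop 0] with n hn
    have : (n : ℝ) ≠ 0 := by positivity
    exact div_div_div_cancel_right₀ this _ _
  have hinv : Tendsto (fun n => (1 - M.transRatio G n fun i => τ i ω)⁻¹) atTop
      (𝓝 (1 - M.transG G)⁻¹) := by
    -- Inversion is continuous at the limit because `I - P_G` is invertible.
    refine (continuousAt_matrix_inv _ ?_).tendsto.comp (tendsto_const_nhds.sub hP)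
    rw [Ring.inverse_eq_inv']
    exact continuousAt_inv₀ hdet
  refine tendsto_pi_nhds.2 fun s => tendsto_pi_nhds.2 fun s' => ?_
  exact (((tendsto_pi_nhds.1 (tendsto_pi_nhds.1 hinv s) s')).mul
    ((h1 s').inv₀ (hν s' s'.2))).neg

theorem tendstoInDistribution_tdError (hEff : M.EffectiveHorizon h) (hR : M.BoundedRewards)
    {G : Finset S} [DecidableEq G] (hlaw : ∀ i, HasLaw (τ i) M.law Pr) (hind : iIndepFun τ Pr) :
    TendstoInDistribution (fun (n : ℕ) ω => (√n)⁻¹ • ∑ k ∈ Finset.range n,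
        (WithLp.toLp 2 fun s : G => M.tdError G s (τ k ω))) atTop
      (id : EuclideanSpace ℝ G → EuclideanSpace ℝ G) (fun _ => Pr)
      (multivariateGaussian 0 (M.covMatrix G)) := by
  have hm : Measurable fun w => (WithLp.toLp 2 fun s : G => M.tdError G s w) := by
    refine (WithLp.measurable_toLp 2 _).comp (measurable_pi_lambda _ fun s => ?_)
    exact M.measurable_tdError G s
  have hinner (w : StatePath S) (u : EuclideanSpace ℝ G) :
      inner ℝ (WithLp.toLp 2 fun s : G => M.tdError G s w) u =
      ∑ s : G, u s * M.tdError G s w := by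
    simp [PiLp.inner_apply]
  have hmu (u : EuclideanSpace ℝ G) : Measurable fun w => ∑ s : G, u s * M.tdError G s w :=
    Finset.measurable_fun_sum _ fun s _ => (M.measurable_tdError G s).const_mul _
  refine tendstoInDistribution_multivariateGaussian (posSemidef_covMatrix hEff hR G)
    (fun i => hm.comp_aemeasurable (hlaw i).aemeasurable)
    (hind.comp (fun _ w => WithLp.toLp 2 fun s : G => M.tdError G s w) fun _ => hm)
    (fun i => ((hlaw i).identDistrib (hlaw 0)).comp hm) (fun u => ?_) (fun u => ?_) fun u => ?_
  · simp_rw [hinner]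
    have := (moments_tdError hEff hR G u.ofLp).1
    rw [← (hlaw 0).map_eq] at this
    exact (memLp_map_measure_iff (hmu u).aestronglyMeasurable (hlaw 0).aemeasurable).1 this
  · simp_rw [hinner]
    rw [← (moments_tdError hEff hR G u.ofLp).2.1, ← (hlaw 0).map_eq,
      integral_map (hlaw 0).aemeasurable (hmu u).aestronglyMeasurable]
  · simp_rw [hinner]
    rw [← (moments_tdError hEff hR G u.ofLp).2.2, ← (hlaw 0).map_eq,
      integral_map (hlaw 0).aemeasurable ((hmu u).pow_const 2).aestronglyMeasurable]

/-- The minus sign in `limitMatrix` cancels in the congruence, and the diagonal factors `1 / ν` turn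
`Λ⋆` into `Σ⋆`. -/
theorem limitMatrix_mul (M : MRP S) (G : Finset S) [DecidableEq G] :
    (Matrix.of (M.limitMatrix G)) * M.covMatrix G * (Matrix.of (M.limitMatrix G))ᵀ =
      (1 - M.transG G)⁻¹ * M.sigmaG G * ((1 - M.transG G)⁻¹)ᵀ := by
  have h1 : Matrix.of (M.limitMatrix G) =
      -((1 - M.transG G)⁻¹ * Matrix.diagonal fun s : G => (M.occ s).toReal⁻¹) := by
    ext s s'
    simp [limitMatrix, Matrix.mul_diagonal]
  have h2 : M.sigmaG G = (Matrix.diagonal fun s : G => (M.occ s).toReal⁻¹) * M.covMatrix G *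
      Matrix.diagonal fun s : G => (M.occ s).toReal⁻¹ := by
    ext s s'
    simp only [sigmaG, covMatrix, Matrix.of_apply, Matrix.mul_diagonal, Matrix.diagonal_mul,
      toReal_lambdaG]
    rw [div_eq_mul_inv, mul_inv]
    ring
  rw [h1, h2]
  simp [Matrix.transpose_mul, Matrix.mul_assoc]

/-- The solution is only assumed to satisfy the equation almost surely, without any measurability in
`ω`. Uniqueness makes it almost surely equal to an explicit measurable function of the data. -/
theorem aemeasurable_solution (hEff : M.EffectiveHorizon h) (hR : M.BoundedRewards)
    {G : Finset S} [DecidableEq G] (hG : M.term ∉ G) (hlaw : ∀ i, HasLaw (τ i) M.law Pr)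
    {n : ℕ} {v : Ω → G → ℝ} (hv : ∀ᵐ ω ∂Pr, M.IsSubgraphBellman G n (fun i => τ i ω) (v ω)) :
    AEMeasurable v Pr := by
  classical
  let mean (s : G) (f : StatePath S → ℝ) (D : ℕ → StatePath S) : ℝ :=
    (∑ i ∈ Finset.range n, M.visitSum s f (D i)) / ∑ i ∈ Finset.range n, M.visitSum s 1 (D i)
  let out : StatePath S → ℝ := fun w =>
    if (w 1).1 ∉ G then ∑ l ∈ Finset.Ico 1 (M.len w), (w l).2 else 0
  let rew : StatePath S → ℝ := fun w => (w 0).2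
  have hmean (s : G) {f : StatePath S → ℝ} (hf : Measurable f) : Measurable (mean s f) :=
    (measurable_sum_comp (M.measurable_visitSum s.1 hf) n).div
      (measurable_sum_comp (M.measurable_visitSum s.1 measurable_one) n)
  have hrew : Measurable rew := by fun_prop
  have hout : Measurable out := by
    refine Measurable.ite (measurableSet_state {x | x ∉ G} 1) ?_ measurable_const
    have h : Measurable fun p : ℕ × StatePath S => ∑ l ∈ Finset.Ico 1 p.1, (p.2 l).2 :=
      measurable_from_prod_countable_right fun n =>
        Finset.measurable_fun_sum (Finset.Ico 1 n) fun l _ => by fun_prop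
    exact h.comp (M.measurable_len.prodMk measurable_id)
  let sol (D : ℕ → StatePath S) : G → ℝ :=
    (1 - M.transRatio G n D)⁻¹ *ᵥ fun s => mean s rew D + mean s out D
  have hsol : Measurable sol := by
    refine measurable_pi_lambda _ fun s => Finset.measurable_fun_sum _ fun s' _ => ?_
    exact (M.measurable_one_sub_transRatio_inv G n s s').mul ((hmean s' hrew).add (hmean s' hout))
  have hτ : AEMeasurable (fun ω i => τ i ω) Pr := aemeasurable_pi_lambda _ fun i =>
    (hlaw i).aemeasurable
  refine (hsol.comp_aemeasurable hτ).congr ?_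
  filter_upwards [hv, ae_data_isRegular hEff hR hlaw] with ω hv hD
  rw [isSubgraphBellman_iff hD hG] at hv
  rw [hv, transHat_eq hD hG]
  simp only [Function.comp_apply, sol]
  congr 1
  funext s
  have hs : s.1 ≠ M.term := fun hs => hG (hs ▸ s.2)
  simp only [Pi.add_apply, rHat, outHat, empCond_eq hD hs]
  rfl

theorem tendstoInDistribution_estimator (hEff : M.EffectiveHorizon h) (hR : M.BoundedRewards)
    {G : Finset S} [DecidableEq G] (hG : M.term ∉ G) (hν : ∀ s ∈ G, 0 < M.occ s)
    (hlaw : ∀ i, HasLaw (τ i) M.law Pr) (hind : iIndepFun τ Pr) {v : ℕ → Ω → G → ℝ}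
    (hv : ∀ n, ∀ᵐ ω ∂Pr, M.IsSubgraphBellman G n (fun i => τ i ω) (v n ω)) :
    TendstoInDistribution
      (fun (n : ℕ) ω => WithLp.toLp 2 (fun s : G => √(n : ℝ) * (M.V s - v n ω s)))
      atTop (id : EuclideanSpace ℝ G → EuclideanSpace ℝ G) (fun _ => Pr)
      (multivariateGaussian 0 ((1 - M.transG G)⁻¹ * M.sigmaG G * ((1 - M.transG G)⁻¹)ᵀ)) := by
  have hne (s : G) : s.1 ≠ M.term := fun hs => hG (hs ▸ s.2)
  have hν' (s : S) (hs : s ∈ G) : 0 < (M.occ s).toReal :=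
    ENNReal.toReal_pos (hν s hs).ne' (occ_ne_top hEff hR (hne ⟨s, hs⟩))
  let g : EuclideanSpace ℝ G × (G → G → ℝ) → EuclideanSpace ℝ G :=
    fun p => WithLp.toLp 2 (Matrix.of p.2 *ᵥ p.1.ofLp)
  have hg : Continuous g := by
    refine (PiLp.continuous_toLp 2 _).comp (continuous_pi fun s => ?_)
    simp only [Matrix.mulVec, dotProduct, Matrix.of_apply]
    fun_prop
  have hτ : AEMeasurable (fun ω i => τ i ω) Pr := aemeasurable_pi_lambda _ fun i =>
    (hlaw i).aemeasurable
  have hEm (n : ℕ) : AEMeasurable (fun ω => M.errorMatrix G n fun i => τ i ω) Pr :=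
    (M.measurable_errorMatrix G n).comp_aemeasurable hτ
  have hE := ae_tendsto_errorMatrix hEff hR hG (fun s hs => (hν' s hs).ne') hlaw hind
  have hslutsky := (tendstoInDistribution_tdError (G := G) hEff hR hlaw
    hind).continuous_comp_prodMk_of_tendstoInMeasure_const hg
    (tendstoInMeasure_of_tendsto_ae (fun n => (hEm n).aestronglyMeasurable) hE) hEm
  have hlim : TendstoInDistribution (fun (n : ℕ) ω => g ((√n)⁻¹ • ∑ k ∈ Finset.range n,
        (WithLp.toLp 2 fun s : G => M.tdError G s (τ k ω)), M.errorMatrix G n fun i => τ i ω))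
      atTop (id : EuclideanSpace ℝ G → EuclideanSpace ℝ G) (fun _ => Pr)
      (multivariateGaussian 0 ((1 - M.transG G)⁻¹ * M.sigmaG G * ((1 - M.transG G)⁻¹)ᵀ)) := by
    refine ⟨hslutsky.forall_aemeasurable, aemeasurable_id, ?_⟩
    -- Slutsky's theorem gives as limit law the image of the Gaussian with covariance `covMatrix`
    -- under `limitMatrix`, which is the Gaussian with the sandwich covariance.
    convert! hslutsky.tendsto using 2
    refine congrArg 𝓝 (Subtype.ext ?_)
    simp only [Measure.map_id]
    rw [← limitMatrix_mul, ← multivariateGaussian_map_mulVec (posSemidef_covMatrix hEff hR G)]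
    rfl
  have hUm (n : ℕ) : AEMeasurable
      (fun ω => WithLp.toLp 2 (fun s : G => √(n : ℝ) * (M.V s - v n ω s))) Pr := by
    have hvn := aemeasurable_solution hEff hR hG hlaw (hv n)
    refine (WithLp.measurable_toLp 2 _).comp_aemeasurable (aemeasurable_pi_lambda _ fun s => ?_)
    exact ((aemeasurable_pi_iff.1 hvn s).const_sub _).const_mul _
  -- The formula for the error holds only once all states of `G` have been visited. Since the visit
  -- frequencies converge to `ν > 0`, the scaled error and the Slutsky expression almost surely
  -- coincide for all large `n`.
  refine tendstoInDistribution_of_tendstoInMeasure_sub _ _ hlim ?_ hUm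
  refine tendstoInMeasure_of_tendsto_ae (fun n =>
    ((hUm n).sub (hlim.forall_aemeasurable n)).aestronglyMeasurable) ?_
  have hN : ∀ᵐ ω ∂Pr, ∀ s : G, Tendsto (fun n : ℕ => (∑ i ∈ Finset.range n,
      M.visitSum s 1 (τ i ω)) / n) atTop (𝓝 (M.occ s).toReal) :=
    ae_all_iff.2 fun s => ae_tendsto_visitSum_one hEff hR hlaw hind (hne s)
  filter_upwards [hN, ae_all_iff.2 hv, ae_data_isRegular hEff hR hlaw] with ω hN hv hD
  have hpos : ∀ᶠ n : ℕ in atTop, ∀ s : G,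
      0 < (∑ i ∈ Finset.range n, M.visitSum s 1 (τ i ω)) / n :=
    eventually_all.2 fun s => (hN s).eventually_const_lt (hν' s s.2)
  refine tendsto_const_nhds.congr' ?_
  filter_upwards [hpos, eventually_gt_atTop 0] with n hpos hn
  have hNne (s : G) : ∑ i ∈ Finset.range n, M.visitSum s 1 (τ i ω) ≠ 0 := fun h0 => by
    have := hpos s
    rw [h0, zero_div] at this
    exact lt_irrefl _ this
  have hV := V_sub_eq hD hG (hv n) hNne
  rw [Pi.zero_apply, Pi.sub_apply, Pi.sub_apply, eq_comm, sub_eq_zero]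
  simp only [g]
  congr 1
  funext s
  rw [show M.V s - v n ω s = (fun s : G => M.V s - v n ω s) s from rfl, hV]
  simp only [Matrix.mulVec, dotProduct, Matrix.of_apply, errorMatrix, Finset.mul_sum]
  refine Finset.sum_congr rfl fun s' _ => ?_
  have hn' : (0 : ℝ) < n := by exact_mod_cast hn
  have hsq : √(n : ℝ) * √(n : ℝ) = n := Real.mul_self_sqrt hn'.le
  have hsn : √(n : ℝ) ≠ 0 := (Real.sqrt_pos.2 hn').ne'
  have := hNne s'
  simp only [WithLp.ofLp_smul, WithLp.ofLp_sum, Pi.smul_apply, Finset.sum_apply, smul_eq_mul]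
  field_simp
  rw [sq, hsq]
  ring

end Asymptotics

end MRP

end

open Classical in
theorem lemma1 {S : Type*} [Countable S] [MeasurableSpace S] [MeasurableSingletonClass S]
    (M : MRP S) (h : ℝ) (hEff : M.EffectiveHorizon h) (hR : M.BoundedRewards)
    (G : Finset S) (hG : M.term ∉ G) (s₀ : S) (hs₀ : s₀ ∈ G) (hν : ∀ s ∈ G, 0 < M.occ s)
    {Ω : Type*} [MeasurableSpace Ω] (Pr : Measure Ω) [IsProbabilityMeasure Pr]
    (τ : ℕ → Ω → StatePath S) (hlaw : ∀ i, HasLaw (τ i) M.law Pr) (hind : iIndepFun τ Pr) :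
    -- the estimator is well defined, and so is the asymptotic covariance matrix
    (∀ᵐ ω ∂Pr, ∀ n, ∃! v : G → ℝ, M.IsSubgraphBellman G n (fun i => τ i ω) v) ∧
    IsUnit (1 - M.transG G) ∧
    (∀ s ∈ G, M.occ s ≠ ∞ ∧ ∀ s' ∈ G, M.lambdaG G s s' ≠ ∞) ∧
    (M.sigmaG G).PosSemidef ∧
    -- asymptotic normality
    (∀ Vhat : ℕ → Ω → G → ℝ,
      (∀ n, ∀ᵐ ω ∂Pr, M.IsSubgraphBellman G n (fun i => τ i ω) (Vhat n ω)) →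
      TendstoInDistribution
        (fun (n : ℕ) ω => WithLp.toLp 2 (fun s : G => √(n : ℝ) * (M.V s - Vhat n ω s)))
        atTop (id : EuclideanSpace ℝ G → EuclideanSpace ℝ G) (fun _ => Pr)
        (multivariateGaussian 0 ((1 - M.transG G)⁻¹ * M.sigmaG G * ((1 - M.transG G)⁻¹)ᵀ))) ∧
    -- the bound on the covariance matrix in the positive semidefinite order
    ((2 : ℝ) • M.sigmaX G + (2 : ℝ) • M.sigmaY G - M.sigmaG G).PosSemidef := by
  have hne (s : S) (hs : s ∈ G) : s ≠ M.term := fun h => hG (h ▸ hs)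
  refine ⟨?_, MRP.isUnit_one_sub_transG hEff hR hG,
    fun s hs => ⟨MRP.occ_ne_top hEff hR (hne s hs), fun s' _ => MRP.lambdaG_ne_top hEff hR G s s'⟩,
    MRP.posSemidef_sigmaG hEff hR G,
    fun Vhat hV => MRP.tendstoInDistribution_estimator hEff hR hG hν hlaw hind hV,
    MRP.posSemidef_two_smul_sub hEff hR G fun s hs =>
      (ENNReal.toReal_pos (hν s hs).ne' (MRP.occ_ne_top hEff hR (hne s hs))).ne'⟩
  filter_upwards [MRP.ae_data_isRegular hEff hR hlaw] with ω hD n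
  exact ⟨_, (MRP.isSubgraphBellman_iff hD hG n _).2 rfl,
    fun v hv => (MRP.isSubgraphBellman_iff hD hG n v).1 hv⟩
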